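/- Graphs are finite and loopless; parallel edges are allowed. An $A$-flow on $G$, for an abelian group $A$, assigns to each edge an orientation and a value in $A$ so that at every vertex the values on incoming edges and on outgoing edges have equal sums; reorienting an edge reverses its orientation and negates its value, and the flow is considered unchanged. A pair of adjacent edges is \emph{confluent} (resp. \emph{contrafluent}) if, after reorienting them so that they form an oriented path of length two (or an oriented circuit of length two if they are parallel), their values are equal (resp. opposite). Two distinct pairs of adjacent edges \emph{strongly intersect} if they share an edge and the subgraph formed by their edges has a vertex of degree three. A \emph{circuit} is a connected $2$-regular graph. A \emph{circuit chain} of $G$ is the union of a sequence $C_1,\dots,C_n$ ($n\ge 1$) of circuits of $G$ such that consecutive circuits have exactly one common vertex and non-consecutive circuits are vertex-disjoint. Given a set of vertex-disjoint circuit chains, two edges are \emph{consecutive} on them if they are adjacent and belong to the same circuit $C_i$ of one of the chains. A \emph{chain edge} of a $(\mathbb{Z}_k\times\mathbb{Z}_2)$-flow is an edge whose value has second coordinate $1$. \textbf{Lemma.} Let $G$ be a $3$-edge-connected graph with maximum degree $\Delta$, let $k=8\Delta-13$, let $e^*$ be an edge of $G$ with a fixed orientation, and let $(a,b)\in\mathbb{Z}_k\times\mathbb{Z}_2$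 with $(a,b)\neq(0,0)$. Then $G$ admits a nowhere-zero $(\mathbb{Z}_k\times\mathbb{Z}_2)$-flow $\phi$ such that: \begin{itemize} \item after reorienting $e^*$ in $\phi$ to the fixed orientation, $\phi(e^*)=(a,b)$; \item the chain edges of $\phi$ induce a (possibly empty) set of vertex-disjoint circuit chains; \item no two pairs of adjacent edges that are confluent in $\phi$ strongly intersect; \item every pair of adjacent edges that is contrafluent in $\phi$ is consecutive on these circuit chains. \end{itemize} -/

import Mathlib

namespace Graph

variable {α β : Type*}

/-- The degree of a vertex: the number of incident edges, loops counted twice. -/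
noncomputable def vertexDegree (G : Graph α β) (v : α) : ℕ :=
  (G.incidenceSet v).ncard + (G.loopSet v).ncard

/-- `Δ` is the maximum degree of `G`. -/
def HasMaxDegree (G : Graph α β) (Δ : ℕ) : Prop :=
  IsGreatest (G.vertexDegree '' G.vertexSet) Δ

/-- A connected graph: it has a vertex, and every two vertices are joined by a walk. -/
def IsConnected (G : Graph α β) : Prop :=
  G.vertexSet.Nonempty ∧
    ∀ u ∈ G.vertexSet, ∀ v ∈ G.vertexSet, Relation.ReflTransGen G.Adj u v

/-- `n`-edge-connected: at least two vertices, and deleting fewer than `n` edges never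
disconnects the graph. -/
def IsEdgeConnected (G : Graph α β) (n : ℕ) : Prop :=
  G.vertexSet.Nontrivial ∧
    ∀ F ⊆ G.edgeSet, F.encard < n → (G.deleteEdges F).IsConnected

/-- A circuit is a `2`-regular connected graph (two parallel edges form a circuit). -/
def IsCircuit (C : Graph α β) : Prop :=
  C.IsConnected ∧ ∀ v ∈ C.vertexSet, C.vertexDegree v = 2

/-- A circuit chain of `G`, given by its sequence of `n ≥ 1` circuits of `G`: consecutive
circuits meet in exactly one vertex, non-consecutive ones are vertex-disjoint. -/
structure CircuitChain (G : Graph α β) where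
  /-- the number of circuits -/
  n : ℕ
  one_le : 1 ≤ n
  /-- the circuits -/
  circuit : Fin n → Graph α β
  isCircuit : ∀ i, (circuit i).IsCircuit
  le : ∀ i, circuit i ≤ G
  inter : ∀ i j : Fin n, i.val + 1 = j.val →
    ∃ v, (circuit i).vertexSet ∩ (circuit j).vertexSet = {v}
  disjoint : ∀ i j : Fin n, i.val + 1 < j.val →
    Disjoint (circuit i).vertexSet (circuit j).vertexSet

/-- The vertices of a circuit chain. -/
def CircuitChain.vertices {G : Graph α β} (D : G.CircuitChain) : Set α :=
  ⋃ i, (D.circuit i).vertexSet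

/-- The edges of a circuit chain. -/
def CircuitChain.edges {G : Graph α β} (D : G.CircuitChain) : Set β :=
  ⋃ i, (D.circuit i).edgeSet

/-- Two distinct edges are adjacent if they have a common end. -/
def AdjacentEdges (G : Graph α β) (e f : β) : Prop :=
  e ≠ f ∧ ∃ v, G.Inc e v ∧ G.Inc f v

/-- Two edges are consecutive on a set of circuit chains: they are adjacent and belong to the
same circuit of one of the chains. -/
def ConsecutiveOn (G : Graph α β) (𝒟 : Set G.CircuitChain) (e f : β) : Prop :=
  G.AdjacentEdges e f ∧
    ∃ D ∈ 𝒟, ∃ i, e ∈ (D.circuit i).edgeSet ∧ f ∈ (D.circuit i).edgeSet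

/-- Two distinct pairs of edges strongly intersect if they share an edge and the subgraph
formed by their edges has a vertex of degree three. -/
def StronglyIntersecting (G : Graph α β) (p q : Sym2 β) : Prop :=
  p ≠ q ∧ (∃ e, e ∈ p ∧ e ∈ q) ∧ ∃ v, (G.restrict {e | e ∈ p ∨ e ∈ q}).vertexDegree v = 3

/-- An `A`-flow on `G`: orientations and values of the edges such that, at every vertex, the
values on incoming edges and on outgoing edges have equal sums.
(The data at elements of `β` that are not edges of `G` are irrelevant.) -/
structure GroupFlow (G : Graph α β) (A : Type*) [AddCommGroup A] where
  tail : β → α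
  head : β → α
  isLink : ∀ e ∈ G.edgeSet, G.IsLink e (tail e) (head e)
  val : β → A
  conservation : ∀ v ∈ G.vertexSet,
    ∑ᶠ e ∈ {e | e ∈ G.edgeSet ∧ head e = v}, val e =
      ∑ᶠ e ∈ {e | e ∈ G.edgeSet ∧ tail e = v}, val e

namespace GroupFlow

variable {G : Graph α β} {A : Type*} [AddCommGroup A]

/-- The flow is nonzero on every edge. -/
def NowhereZero (φ : G.GroupFlow A) : Prop :=
  ∀ e ∈ G.edgeSet, φ.val e ≠ 0

open Classical in
/-- The value of the (non-loop) edge `e` with ends `x` and `y` after reorienting it, if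
necessary, from `x` to `y`. -/
noncomputable def valAlong (φ : G.GroupFlow A) (e : β) (x y : α) : A :=
  if φ.tail e = x ∧ φ.head e = y then φ.val e else -φ.val e

/-- Distinct edges `e` and `f` are confluent: oriented consistently, along an oriented path
`x, v, y` of length two (an oriented circuit if `x = y`), they have equal values. -/
def Confluent (φ : G.GroupFlow A) (e f : β) : Prop :=
  e ≠ f ∧ ∃ x v y, G.IsLink e x v ∧ G.IsLink f v y ∧ φ.valAlong e x v = φ.valAlong f v y

/-- Distinct edges `e` and `f` are contrafluent: oriented consistently, they have opposite
values. -/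
def Contrafluent (φ : G.GroupFlow A) (e f : β) : Prop :=
  e ≠ f ∧ ∃ x v y, G.IsLink e x v ∧ G.IsLink f v y ∧ φ.valAlong e x v = -φ.valAlong f v y

/-- The chain edges: those whose value has second coordinate `1`. -/
def chainEdges {k : ℕ} (φ : G.GroupFlow (ZMod k × ZMod 2)) : Set β :=
  {e | e ∈ G.edgeSet ∧ (φ.val e).2 = 1}

/-- The chain edges of `φ` induce the pairwise vertex-disjoint circuit chains in `𝒟`. -/
def ChainEdgesInduce {k : ℕ} (φ : G.GroupFlow (ZMod k × ZMod 2)) (𝒟 : Set G.CircuitChain) :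
    Prop :=
  𝒟.PairwiseDisjoint CircuitChain.vertices ∧ φ.chainEdges = ⋃ D ∈ 𝒟, D.edges

end GroupFlow

end Graph

namespace Graph

section Paths

variable {α β : Type*} {G H : Graph α β} {u v w p q : α} {V V₁ V₂ T : Set α} {E E₁ E₂ : Set β}
  {e : β}

/-- `G.IsPathOn u v V E`: there is a path of `G` from `u` to `v` with vertex set `V` and
edge set `E`. -/
inductive IsPathOn (G : Graph α β) : α → α → Set α → Set β → Prop
  | nil {u : α} (hu : u ∈ V(G)) : IsPathOn G u u {u} ∅
  | cons {u w v : α} {e : β} {V : Set α} {E : Set β} (he : G.IsLink e u w)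
      (h : IsPathOn G w v V E) (hu : u ∉ V) : IsPathOn G u v (insert u V) (insert e E)

namespace IsPathOn

lemma left_mem (h : G.IsPathOn u v V E) : u ∈ V := by
  cases h <;> simp

lemma right_mem (h : G.IsPathOn u v V E) : v ∈ V := by
  induction h with
  | nil => simp
  | cons _ _ _ ih => exact Or.inr ih

lemma subset (h : G.IsPathOn u v V E) : V ⊆ V(G) := by
  induction h with
  | nil hu => simpa
  | cons he _ _ ih => exact Set.insert_subset he.left_mem ih

lemma ends_mem (h : G.IsPathOn u v V E) (he : e ∈ E) :
    ∃ x y, G.IsLink e x y ∧ x ∈ V ∧ y ∈ V := by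
  induction h with
  | nil => simp at he
  | cons he' h' _ ih =>
    rcases he with rfl | he
    · exact ⟨_, _, he', Or.inl rfl, Or.inr h'.left_mem⟩
    · obtain ⟨x, y, h1, h2, h3⟩ := ih he
      exact ⟨x, y, h1, Or.inr h2, Or.inr h3⟩

lemma mem_of_isLink (h : G.IsPathOn u v V E) (he : e ∈ E) (hl : G.IsLink e p q) : p ∈ V := by
  obtain ⟨x, y, h1, h2, h3⟩ := h.ends_mem he
  rcases hl.left_eq_or_eq h1 with rfl | rfl <;> assumption

lemma mono (hHG : H ≤ G) (h : H.IsPathOn u v V E) : G.IsPathOn u v V E := by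
  induction h with
  | nil hu => exact .nil (hHG.vertexSet_mono hu)
  | cons he _ hu ih => exact .cons (he.mono hHG) ih hu

lemma append (h₁ : G.IsPathOn u w V₁ E₁) (h₂ : G.IsPathOn w v V₂ E₂) (hV : V₁ ∩ V₂ ⊆ {w}) :
    G.IsPathOn u v (V₁ ∪ V₂) (E₁ ∪ E₂) := by
  induction h₁ with
  | nil hu =>
    rw [Set.empty_union, Set.union_eq_right.2 (by simpa using h₂.left_mem)]
    exact h₂
  | @cons a b c e V' E' he h hu ih =>
    have := ih h₂ (fun x hx => hV ⟨Or.inr hx.1, hx.2⟩)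
    rw [Set.insert_union, Set.insert_union]
    refine .cons he this ?_
    rintro (h' | h')
    · exact hu h'
    · have : a = c := hV ⟨Or.inl rfl, h'⟩
      exact hu (this ▸ h.right_mem)

lemma single (he : G.IsLink e u v) (huv : u ≠ v) : G.IsPathOn u v {u, v} {e} := by
  have := IsPathOn.cons he (.nil he.right_mem) (by simpa using huv)
  simpa using this

lemma reverse (h : G.IsPathOn u v V E) : G.IsPathOn v u V E := by
  induction h with
  | nil hu => exact .nil hu
  | @cons a b c e V' E' he h hu ih =>
    have hab : a ≠ b := fun hab => hu (hab ▸ h.left_mem)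
    have := ih.append (single he.symm hab.symm) (by
      rintro x ⟨h1, rfl | rfl⟩
      · rfl
      · exact absurd h1 hu)
    convert this using 1
    · ext x
      have := h.left_mem
      simp only [Set.mem_insert_iff, Set.mem_union, Set.mem_singleton_iff]
      grind
    · rw [Set.union_comm]; rfl

lemma split (h : G.IsPathOn u v V E) (hw : w ∈ V) :
    ∃ V₁ E₁ V₂ E₂, G.IsPathOn u w V₁ E₁ ∧ G.IsPathOn w v V₂ E₂ ∧ V = V₁ ∪ V₂ ∧ E = E₁ ∪ E₂ ∧
      V₁ ∩ V₂ ⊆ {w} := by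
  induction h with
  | nil hu =>
    obtain rfl : w = _ := hw
    exact ⟨_, _, _, _, .nil hu, .nil hu, by simp, by simp, by simp⟩
  | @cons a b c e V' E' he h hu ih =>
    by_cases hwa : w = a
    · subst hwa
      exact ⟨_, _, _, _, .nil he.left_mem, .cons he h hu, by simp, by simp, by simp⟩
    · obtain ⟨V₁, E₁, V₂, E₂, h1, h2, rfl, rfl, h5⟩ := ih (hw.resolve_left hwa)
      refine ⟨_, _, _, _, .cons he h1 (fun h' => hu (Or.inl h')), h2, by rw [Set.insert_union],
        by rw [Set.insert_union], ?_⟩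
      rintro x ⟨rfl | hx, hx'⟩
      · exact absurd (Or.inr hx') hu
      · exact h5 ⟨hx, hx'⟩

/-- The part of a path up to its first vertex in `T`. -/
lemma exists_prefix (h : G.IsPathOn u v V E) (hv : v ∈ T) :
    ∃ w ∈ T, ∃ V₁ E₁, G.IsPathOn u w V₁ E₁ ∧ V₁ ⊆ V ∧ E₁ ⊆ E ∧ V₁ ∩ T ⊆ {w} ∧
      (w = v → V ∩ T ⊆ {v}) := by
  induction h with
  | nil hu => exact ⟨_, hv, _, _, .nil hu, subset_rfl, subset_rfl, by simp, by simp⟩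
  | @cons a b c e V' E' he h hu ih =>
    by_cases ha : a ∈ T
    · exact ⟨a, ha, _, _, .nil he.left_mem, by simp, by simp, by simp,
        fun hac => absurd (hac ▸ h.right_mem) hu⟩
    · obtain ⟨w, hw, V₁, E₁, h1, h2, h3, h4, h5⟩ := ih hv
      refine ⟨w, hw, _, _, .cons he h1 (fun h' => hu (h2 h')), Set.insert_subset_insert h2,
        Set.insert_subset_insert h3, ?_, fun hwc => ?_⟩
      · rintro x ⟨rfl | hx, hx'⟩
        · exact absurd hx' ha
        · exact h4 ⟨hx, hx'⟩
      · rintro x ⟨rfl | hx, hx'⟩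
        · exact absurd hx' ha
        · exact h5 hwc ⟨hx, hx'⟩

/-- A nontrivial path has exactly one edge at its first vertex. -/
lemma exists_first_edge (h : G.IsPathOn u v V E) (huv : u ≠ v) :
    ∃ e ∈ E, ∀ f ∈ E, G.Inc f u ↔ f = e := by
  cases h with
  | nil => exact absurd rfl huv
  | @cons _ b _ e V' E' he h hu =>
    refine ⟨e, Or.inl rfl, fun f hf => ⟨fun hfu => ?_, fun h => h ▸ he.inc_left⟩⟩
    rcases hf with rfl | hf
    · rfl
    · obtain ⟨y, hy⟩ := hfu
      exact absurd (h.mem_of_isLink hf hy) hu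

end IsPathOn

/-- A vertex set that contains `u` and is closed under adjacency, up to paths from `u`. -/
lemma exists_isPathOn_of_cut (hu : u ∈ V(G))
    (h : ∀ R ⊆ V(G), u ∈ R → v ∉ R → ∃ e x y, G.IsLink e x y ∧ x ∈ R ∧ y ∉ R) :
    ∃ V E, G.IsPathOn u v V E := by
  by_contra hv
  obtain ⟨e, x, y, he, ⟨V, E, hx⟩, hy⟩ := h {w | ∃ V E, G.IsPathOn u w V E}
    (fun w ⟨V, E, hw⟩ => hw.subset hw.right_mem) ⟨_, _, .nil hu⟩ hv
  apply hy
  by_cases hyV : y ∈ V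
  · obtain ⟨V₁, E₁, _, _, h1, -⟩ := hx.split hyV
    exact ⟨_, _, h1⟩
  · refine ⟨_, _, hx.append (.single he (fun hxy => hyV (hxy ▸ hx.right_mem))) ?_⟩
    rintro z ⟨hz, rfl | rfl⟩
    · rfl
    · exact absurd hz hyV

end Paths

section Circuits

variable {α β : Type*} {G H : Graph α β} {u v w p q r s : α} {V V₁ V₂ T : Set α}
  {E E₁ E₂ : Set β} {e : β}

/-- The union of two internally disjoint paths from `p` to `q`. -/
def IsTheta (G : Graph α β) (p q : α) (V : Set α) (E : Set β) : Prop :=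
  p ≠ q ∧ ∃ V₁ E₁ V₂ E₂, G.IsPathOn p q V₁ E₁ ∧ G.IsPathOn p q V₂ E₂ ∧ V₁ ∩ V₂ ⊆ {p, q} ∧
    Disjoint E₁ E₂ ∧ V = V₁ ∪ V₂ ∧ E = E₁ ∪ E₂

/-- The pair of the vertex set and the edge set of a circuit of `G`. -/
def IsCircuitPair (G : Graph α β) (C : Set α × Set β) : Prop :=
  ∃ p q, G.IsTheta p q C.1 C.2

namespace IsTheta

lemma symm (h : G.IsTheta p q V E) : G.IsTheta q p V E := by
  obtain ⟨hpq, V₁, E₁, V₂, E₂, h1, h2, h3, h4, h5, h6⟩ := h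
  exact ⟨hpq.symm, V₁, E₁, V₂, E₂, h1.reverse, h2.reverse, by rwa [Set.pair_comm], h4, h5, h6⟩

lemma disjoint_of_inter [G.Loopless] (h₁ : G.IsPathOn u v V₁ E₁) (h₂ : G.IsPathOn p q V₂ E₂)
    (h : V₁ ∩ V₂ ⊆ {w}) : Disjoint E₁ E₂ := by
  rw [Set.disjoint_left]
  intro e he1 he2
  obtain ⟨x, y, hl, -⟩ := h₁.ends_mem he1
  have hx : x = w := h ⟨h₁.mem_of_isLink he1 hl, h₂.mem_of_isLink he2 hl⟩
  have hy : y = w := h ⟨h₁.mem_of_isLink he1 hl.symm, h₂.mem_of_isLink he2 hl.symm⟩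
  exact hl.ne (hx.trans hy.symm)

lemma move_right_aux [G.Loopless] (hpr : p ≠ r) (h₁ : G.IsPathOn p q V₁ E₁)
    (h₂ : G.IsPathOn p q V₂ E₂) (hV : V₁ ∩ V₂ ⊆ {p, q}) (hE : Disjoint E₁ E₂) (hr : r ∈ V₁) :
    G.IsTheta p r (V₁ ∪ V₂) (E₁ ∪ E₂) := by
  obtain ⟨A, EA, B, EB, hA, hB, rfl, rfl, hAB⟩ := h₁.split hr
  have hpB : p ∉ B := fun hp => hpr (hAB ⟨hA.left_mem, hp⟩)
  have h' := h₂.append hB.reverse (by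
    rintro x ⟨hx2, hxB⟩
    rcases hV ⟨Or.inr hxB, hx2⟩ with rfl | rfl
    · exact absurd hxB hpB
    · rfl)
  refine ⟨hpr, _, _, _, _, hA, h', ?_, ?_, ?_, ?_⟩
  · rintro x ⟨hxA, hx | hx⟩
    · rcases hV ⟨Or.inl hxA, hx⟩ with rfl | rfl
      · exact Or.inl rfl
      · exact Or.inr (hAB ⟨hxA, hB.right_mem⟩)
    · exact Or.inr (hAB ⟨hxA, hx⟩)
  · rw [Set.disjoint_union_right]
    exact ⟨hE.mono_left Set.subset_union_left, disjoint_of_inter hA hB hAB⟩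
  · rw [Set.union_assoc, Set.union_comm B]
  · rw [Set.union_assoc, Set.union_comm EB]

lemma move_right [G.Loopless] (h : G.IsTheta p q V E) (hpr : p ≠ r) (hr : r ∈ V) :
    G.IsTheta p r V E := by
  obtain ⟨hpq, V₁, E₁, V₂, E₂, h1, h2, h3, h4, rfl, rfl⟩ := h
  rcases hr with hr | hr
  · exact move_right_aux hpr h1 h2 h3 h4 hr
  · rw [Set.union_comm V₁, Set.union_comm E₁]
    exact move_right_aux hpr h2 h1 (by rwa [Set.inter_comm]) h4.symm hr

lemma left_mem (h : G.IsTheta p q V E) : p ∈ V := by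
  obtain ⟨hpq, V₁, E₁, V₂, E₂, h1, h2, h3, h4, rfl, rfl⟩ := h
  exact Or.inl h1.left_mem

lemma move [G.Loopless] (h : G.IsTheta p q V E) (hr : r ∈ V) (hs : s ∈ V) (hrs : r ≠ s) :
    G.IsTheta r s V E := by
  by_cases hpr : p = r
  · exact hpr ▸ h.move_right (hpr ▸ hrs) hs
  · exact (h.move_right hpr hr).symm.move_right hrs hs

lemma mono (hHG : H ≤ G) (h : H.IsTheta p q V E) : G.IsTheta p q V E := by
  obtain ⟨hpq, V₁, E₁, V₂, E₂, h1, h2, h3⟩ := h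
  exact ⟨hpq, V₁, E₁, V₂, E₂, h1.mono hHG, h2.mono hHG, h3⟩

lemma ends_mem (h : G.IsTheta p q V E) (he : e ∈ E) :
    ∃ x y, G.IsLink e x y ∧ x ∈ V ∧ y ∈ V := by
  obtain ⟨hpq, V₁, E₁, V₂, E₂, h1, h2, h3, h4, rfl, rfl⟩ := h
  rcases he with he | he
  · obtain ⟨x, y, h, hx, hy⟩ := h1.ends_mem he
    exact ⟨x, y, h, Or.inl hx, Or.inl hy⟩
  · obtain ⟨x, y, h, hx, hy⟩ := h2.ends_mem he
    exact ⟨x, y, h, Or.inr hx, Or.inr hy⟩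

lemma subset (h : G.IsTheta p q V E) : V ⊆ V(G) := by
  obtain ⟨hpq, V₁, E₁, V₂, E₂, h1, h2, h3, h4, rfl, rfl⟩ := h
  exact Set.union_subset h1.subset h2.subset

lemma exists_pair (h : G.IsTheta p q V E) :
    ∃ e ∈ E, ∃ f ∈ E, e ≠ f ∧ ∀ g ∈ E, G.Inc g p ↔ g = e ∨ g = f := by
  obtain ⟨hpq, V₁, E₁, V₂, E₂, h1, h2, h3, h4, rfl, rfl⟩ := h
  obtain ⟨e, he, he'⟩ := h1.exists_first_edge hpq
  obtain ⟨f, hf, hf'⟩ := h2.exists_first_edge hpq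
  refine ⟨e, Or.inl he, f, Or.inr hf, fun hef => Set.disjoint_left.1 h4 he (hef ▸ hf), ?_⟩
  rintro g (hg | hg)
  · rw [he' g hg]
    refine ⟨Or.inl, fun h => h.resolve_right ?_⟩
    rintro rfl
    exact Set.disjoint_left.1 h4 hg hf
  · rw [hf' g hg]
    refine ⟨Or.inr, fun h => h.resolve_left ?_⟩
    rintro rfl
    exact Set.disjoint_left.1 h4 he hg

end IsTheta

namespace IsCircuitPair

variable {C K : Set α × Set β}

lemma isTheta [G.Loopless] (h : G.IsCircuitPair C) (hr : r ∈ C.1) (hs : s ∈ C.1) (hrs : r ≠ s) :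
    G.IsTheta r s C.1 C.2 := by
  obtain ⟨p, q, h⟩ := h
  exact h.move hr hs hrs

lemma mono (hHG : H ≤ G) (h : H.IsCircuitPair C) : G.IsCircuitPair C := by
  obtain ⟨p, q, h⟩ := h
  exact ⟨p, q, h.mono hHG⟩

lemma exists_ne (h : G.IsCircuitPair C) (u : α) : ∃ v ∈ C.1, v ≠ u := by
  obtain ⟨p, q, h⟩ := h
  by_cases hp : p = u
  · exact ⟨q, h.symm.left_mem, fun hq => h.1 (hp.trans hq.symm)⟩
  · exact ⟨p, h.left_mem, hp⟩

lemma exists_pair [G.Loopless] (h : G.IsCircuitPair C) (hu : u ∈ C.1) :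
    ∃ e ∈ C.2, ∃ f ∈ C.2, e ≠ f ∧ ∀ g ∈ C.2, G.Inc g u ↔ g = e ∨ g = f := by
  obtain ⟨v, hv, hvu⟩ := h.exists_ne u
  exact (h.isTheta hu hv hvu.symm).exists_pair

lemma mem_of_isLink (h : G.IsCircuitPair C) (he : e ∈ C.2) (hl : G.IsLink e p q) : p ∈ C.1 := by
  obtain ⟨p', q', h⟩ := h
  obtain ⟨x, y, h1, h2, h3⟩ := h.ends_mem he
  rcases hl.left_eq_or_eq h1 with rfl | rfl <;> assumption

lemma mem_edgeSet (h : G.IsCircuitPair C) (he : e ∈ C.2) : e ∈ E(G) := by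
  obtain ⟨p', q', h⟩ := h
  obtain ⟨x, y, h1, h2, h3⟩ := h.ends_mem he
  exact h1.edge_mem

lemma mem_of_inc (h : G.IsCircuitPair C) (he : e ∈ C.2) (hl : G.Inc e p) : p ∈ C.1 :=
  h.mem_of_isLink he hl.choose_spec

lemma subset (h : G.IsCircuitPair C) : C.1 ⊆ V(G) := by
  obtain ⟨p', q', h⟩ := h
  exact h.subset

/-- An edge whose ends are joined by a path avoiding it lies in a circuit. -/
lemma of_isPathOn [G.Loopless] (he : G.IsLink e u v)
    (h : (G.deleteEdges {e}).IsPathOn u v V E) : G.IsCircuitPair (V ∪ {u, v}, E ∪ {e}) := by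
  refine ⟨u, v, he.ne, _, _, _, _, h.mono deleteEdges_le, .single he he.ne,
    Set.inter_subset_right, ?_, rfl, rfl⟩
  rw [Set.disjoint_singleton_right]
  intro h'
  obtain ⟨x, y, hl, -⟩ := h.ends_mem h'
  have := hl.edge_mem
  simp at this

/-- If two circuits have at least two common vertices, then a vertex `p` of the first outside the
second and a vertex `v` of the second lie on a common circuit of their union. -/
lemma exists_through [G.Loopless] (hC : G.IsCircuitPair C) (hK : G.IsCircuitPair K)
    (hp : p ∈ C.1) (hpK : p ∉ K.1) (hv : v ∈ K.1) (hq : q ∈ C.1) (hqK : q ∈ K.1)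
    (hr : r ∈ C.1) (hrK : r ∈ K.1) (hqr : q ≠ r) :
    ∃ C', G.IsCircuitPair C' ∧ p ∈ C'.1 ∧ v ∈ C'.1 ∧ C'.1 ⊆ C.1 ∪ K.1 := by
  have hpq : p ≠ q := fun h => hpK (h ▸ hqK)
  obtain ⟨-, V₁, E₁, V₂, E₂, h1, h2, hV, hE, hCV, hCE⟩ := hC.isTheta hp hq hpq
  obtain ⟨q₁, hq₁, A, EA, hA, hAV, hAE, hAT, hA'⟩ := h1.exists_prefix hqK
  obtain ⟨q₂, hq₂, B, EB, hB, hBV, hBE, hBT, hB'⟩ := h2.exists_prefix hqK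
  have hne : q₁ ≠ q₂ := by
    rintro rfl
    rcases hV ⟨hAV hA.right_mem, hBV hB.right_mem⟩ with rfl | h
    · exact hpK hq₁
    · obtain rfl : q₁ = q := h
      rw [hCV] at hr
      rcases hr with hr | hr
      · exact hqr (hA' rfl ⟨hr, hrK⟩).symm
      · exact hqr (hB' rfl ⟨hr, hrK⟩).symm
  have hAB : A ∩ B ⊆ {p} := by
    rintro x ⟨hxA, hxB⟩
    rcases hV ⟨hAV hxA, hBV hxB⟩ with rfl | rfl
    · rfl
    · exact absurd ((hAT ⟨hxA, hqK⟩).symm.trans (hBT ⟨hxB, hqK⟩)) hne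
  have hR := hA.reverse.append hB hAB
  have hRK : (A ∪ B) ∩ K.1 ⊆ {q₁, q₂} := by
    rintro x ⟨hx | hx, hxK⟩
    · exact Or.inl (hAT ⟨hx, hxK⟩)
    · exact Or.inr (hBT ⟨hx, hxK⟩)
  have main : ∀ W F, G.IsPathOn q₁ q₂ W F → W ⊆ K.1 → v ∈ W →
      ∃ C', G.IsCircuitPair C' ∧ p ∈ C'.1 ∧ v ∈ C'.1 ∧ C'.1 ⊆ C.1 ∪ K.1 := by
    intro W F hW hWK hvW
    refine ⟨(A ∪ B ∪ W, EA ∪ EB ∪ F), ⟨q₁, q₂, hne, _, _, _, _, hR, hW,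
      fun x hx => hRK ⟨hx.1, hWK hx.2⟩, ?_, rfl, rfl⟩, Or.inl (Or.inl hA.left_mem), Or.inr hvW, ?_⟩
    · rw [Set.disjoint_union_left]
      exact ⟨IsTheta.disjoint_of_inter hA hW fun x hx => hAT ⟨hx.1, hWK hx.2⟩,
        IsTheta.disjoint_of_inter hB hW fun x hx => hBT ⟨hx.1, hWK hx.2⟩⟩
    · rw [hCV]
      exact Set.union_subset_union (Set.union_subset_union hAV hBV) hWK
  obtain ⟨-, W₁, F₁, W₂, F₂, k1, k2, -, -, hKV, -⟩ := hK.isTheta hq₁ hq₂ hne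
  rcases hKV ▸ hv with hv | hv
  · exact main _ _ k1 (hKV ▸ Set.subset_union_left) hv
  · exact main _ _ k2 (hKV ▸ Set.subset_union_right) hv

/-- The circuit with the given vertices and edges. -/
def toGraph (G : Graph α β) (C : Set α × Set β)
    (hC : ∀ e ∈ C.2, ∀ x y, G.IsLink e x y → x ∈ C.1) (hE : C.2 ⊆ E(G)) : Graph α β where
  vertexSet := C.1
  IsLink e x y := e ∈ C.2 ∧ G.IsLink e x y
  edgeSet := C.2
  isLink_symm e he := ⟨fun x y h => ⟨h.1, h.2.symm⟩⟩
  eq_or_eq_of_isLink_of_isLink e x y v w h h' := h.2.left_eq_or_eq h'.2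
  edge_mem_iff_exists_isLink e := by
    refine ⟨fun he => ?_, fun ⟨x, y, h⟩ => h.1⟩
    obtain ⟨x, y, h⟩ := exists_isLink_of_mem_edgeSet (hE he)
    exact ⟨x, y, he, h⟩
  left_mem_of_isLink e x y h := hC e h.1 x y h.2

end IsCircuitPair

lemma IsPathOn.reflTransGen {H : Graph α β} (h : G.IsPathOn u v V E)
    (hH : ∀ e ∈ E, ∀ x y, G.IsLink e x y → H.IsLink e x y) :
    Relation.ReflTransGen H.Adj u v := by
  induction h with
  | nil => exact .refl
  | cons he _ _ ih =>
    exact .head ⟨_, hH _ (Or.inl rfl) _ _ he⟩ (ih fun e he => hH e (Or.inr he))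

lemma IsCircuitPair.exists_isCircuit [G.Loopless] {C : Set α × Set β} (h : G.IsCircuitPair C) :
    ∃ H : Graph α β, H ≤ G ∧ H.IsCircuit ∧ V(H) = C.1 ∧ E(H) = C.2 := by
  refine ⟨toGraph G C (fun e he x y hl => h.mem_of_isLink he hl)
    (fun e he => h.mem_edgeSet he), ⟨h.subset, fun e x y h => h.2⟩, ⟨⟨?_, ?_⟩, ?_⟩, rfl, rfl⟩
  · obtain ⟨p, q, h⟩ := h
    exact ⟨p, h.left_mem⟩
  · intro u hu v hv
    by_cases huv : u = v
    · exact huv ▸ .refl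
    · obtain ⟨-, V₁, E₁, V₂, E₂, h1, h2, h3, h4, h5, h6⟩ := h.isTheta hu hv huv
      exact h1.reflTransGen fun e he x y hl => ⟨h6 ▸ Or.inl he, hl⟩
  · intro v hv
    obtain ⟨e, he, f, hf, hef, hg⟩ := h.exists_pair hv
    have h1 : (toGraph G C (fun e he x y hl => h.mem_of_isLink he hl)
        (fun e he => h.mem_edgeSet he)).incidenceSet v = {e, f} := by
      ext g
      simp only [mem_incidenceSet, Set.mem_insert_iff, Set.mem_singleton_iff]
      constructor
      · rintro ⟨y, hg', hl⟩
        exact (hg g hg').1 hl.inc_left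
      · intro h'
        have hgC : g ∈ C.2 := by rcases h' with rfl | rfl <;> assumption
        obtain ⟨y, hy⟩ := (hg g hgC).2 h'
        exact ⟨y, hgC, hy⟩
    have h2 : (toGraph G C (fun e he x y hl => h.mem_of_isLink he hl)
        (fun e he => h.mem_edgeSet he)).loopSet v = ∅ := by
      ext g
      simp only [mem_loopSet, Set.mem_empty_iff_false, iff_false]
      exact fun hg' => hg'.2.ne rfl
    rw [vertexDegree, h1, h2, Set.ncard_pair hef, Set.ncard_empty]

end Circuits

section Chains

variable {α β : Type*} {G H : Graph α β} {u v w x y : α} {e : β}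
  {C K : Set α × Set β} {L : List (Set α × Set β)}

/-- A list of circuits, each meeting the next one in one vertex and disjoint from the later
ones. -/
def IsChainList (G : Graph α β) : List (Set α × Set β) → Prop
  | [] => True
  | C :: L => G.IsCircuitPair C ∧ G.IsChainList L ∧
      (∀ D ∈ L.head?, ∃ v, C.1 ∩ D.1 = {v}) ∧ ∀ D ∈ L.tail, Disjoint C.1 D.1

namespace IsChainList

lemma mono (hHG : H ≤ G) (h : H.IsChainList L) : G.IsChainList L := by
  induction L with
  | nil => trivial
  | cons C L ih => exact ⟨h.1.mono hHG, ih h.2.1, h.2.2⟩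

lemma isCircuitPair (h : G.IsChainList L) (hC : C ∈ L) : G.IsCircuitPair C := by
  induction L with
  | nil => simp at hC
  | cons D L ih =>
    rcases List.mem_cons.1 hC with rfl | hC
    · exact h.1
    · exact ih h.2.1 hC

/-- A chain starting (at the end of the list) in a circuit through `x` that meets a circuit `K`
can be replaced by a chain starting at `x` and ending in a circuit through a given vertex of `K`. -/
lemma exists_extend [G.Loopless] (hL : G.IsChainList L) (hx : ∃ C ∈ L.getLast?, x ∈ C.1)
    (hK : G.IsCircuitPair K) (hv : v ∈ K.1) (hvL : ∀ C ∈ L, v ∉ C.1)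
    (hm : ∃ C ∈ L, ¬ Disjoint C.1 K.1) :
    ∃ L', G.IsChainList L' ∧ (∃ C ∈ L'.getLast?, x ∈ C.1) ∧ ∃ C ∈ L'.head?, v ∈ C.1 := by
  induction L with
  | nil => simp at hx
  | cons C L ih =>
    by_cases hm' : ∃ C ∈ L, ¬ Disjoint C.1 K.1
    · have hne : L ≠ [] := by rintro rfl; simp at hm'
      refine ih hL.2.1 ?_ (fun C hC => hvL C (List.mem_cons_of_mem _ hC)) hm'
      rwa [List.getLast?_cons_of_ne_nil hne] at hx
    push Not at hm'
    have hCK : ¬ Disjoint C.1 K.1 := by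
      obtain ⟨D, hD, hDK⟩ := hm
      rcases List.mem_cons.1 hD with rfl | hD
      · exact hDK
      · exact absurd (hm' D hD) hDK
    obtain ⟨q, hqC, hqK⟩ := Set.not_disjoint_iff.1 hCK
    by_cases hone : C.1 ∩ K.1 = {q}
    · refine ⟨K :: C :: L, ⟨hK, hL, ?_, ?_⟩, ?_, K, rfl, hv⟩
      · simp only [List.head?_cons, Option.mem_some_iff, forall_eq']
        exact ⟨q, by rwa [Set.inter_comm]⟩
      · exact fun D hD => (hm' D hD).symm
      · rwa [List.getLast?_cons_cons]
    have hr : ∃ r, r ∈ C.1 ∧ r ∈ K.1 ∧ q ≠ r := by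
      by_contra hcon
      push Not at hcon
      exact hone (Set.eq_singleton_iff_unique_mem.2 ⟨⟨hqC, hqK⟩, fun r hr => (hcon r hr.1 hr.2).symm⟩)
    obtain ⟨r, hrC, hrK, hqr⟩ := hr
    cases L with
    | nil =>
      obtain ⟨D, hD, hxC⟩ := hx
      obtain rfl : C = D := by simpa using hD
      by_cases hxK : x ∈ K.1
      · exact ⟨[K], ⟨hK, trivial, by simp, by simp⟩, ⟨K, by simp, hxK⟩, K, by simp, hv⟩
      · obtain ⟨C', h1, h2, h3, h4⟩ := hL.1.exists_through hK hxC hxK hv hqC hqK hrC hrK hqr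
        exact ⟨[C'], ⟨h1, trivial, by simp, by simp⟩, ⟨C', by simp, h2⟩, C', by simp, h3⟩
    | cons D L =>
      obtain ⟨p, hp⟩ := hL.2.2.1 D rfl
      have hpC : p ∈ C.1 ∩ D.1 := hp ▸ rfl
      have hDK := hm' D (by simp)
      obtain ⟨C', h1, h2, h3, h4⟩ := hL.1.exists_through hK hpC.1
        (Set.disjoint_left.1 hDK hpC.2) hv hqC hqK hrC hrK hqr
      refine ⟨C' :: D :: L, ⟨h1, hL.2.1, ?_, ?_⟩, ?_, C', rfl, h3⟩
      · simp only [List.head?_cons, Option.mem_some_iff, forall_eq']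
        refine ⟨p, Set.eq_singleton_iff_unique_mem.2 ⟨⟨h2, hpC.2⟩, ?_⟩⟩
        rintro z ⟨hz, hzD⟩
        rcases h4 hz with hz | hz
        · have : z ∈ C.1 ∩ D.1 := ⟨hz, hzD⟩
          rwa [hp] at this
        · exact absurd hz (Set.disjoint_left.1 hDK hzD)
      · intro F hF
        have h5 : Disjoint C.1 F.1 := hL.2.2.2 F hF
        have h6 : Disjoint F.1 K.1 := hm' F (List.mem_cons_of_mem _ hF)
        exact (Set.disjoint_union_left.2 ⟨h5, h6.symm⟩).mono_left h4
      · rwa [List.getLast?_cons_cons] at hx ⊢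

/-- Every vertex of a chain lies in the first circuit of a final segment of it. -/
lemma exists_suffix (hL : G.IsChainList L) (hx : ∃ C ∈ L.getLast?, x ∈ C.1) (hC : C ∈ L)
    (hv : v ∈ C.1) :
    ∃ L', G.IsChainList L' ∧ (∃ C ∈ L'.getLast?, x ∈ C.1) ∧ ∃ C ∈ L'.head?, v ∈ C.1 := by
  induction L with
  | nil => simp at hx
  | cons D L ih =>
    rcases List.mem_cons.1 hC with rfl | hC
    · exact ⟨C :: L, hL, hx, C, rfl, hv⟩
    · have hne : L ≠ [] := List.ne_nil_of_mem hC
      rw [List.getLast?_cons_of_ne_nil hne] at hx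
      exact ih hL.2.1 hx hC

/-- In a graph in which every cut has at least two edges, any two vertices are joined by a
chain of circuits. -/
lemma exists_of_cut [G.Loopless] (hxy : x ≠ y) (hx : x ∈ V(G)) (hy : y ∈ V(G))
    (h : ∀ R ⊆ V(G), R.Nonempty → R ≠ V(G) → ∃ e u v e' u' v', e' ≠ e ∧ G.IsLink e u v ∧
      u ∈ R ∧ v ∉ R ∧ G.IsLink e' u' v' ∧ u' ∈ R ∧ v' ∉ R) :
    ∃ L, G.IsChainList L ∧ (∃ C ∈ L.getLast?, x ∈ C.1) ∧ ∃ C ∈ L.head?, y ∈ C.1 := by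
  have key : ∀ e u v, G.IsLink e u v → ∃ K, G.IsCircuitPair K ∧ u ∈ K.1 ∧ v ∈ K.1 := by
    intro e u v he
    obtain ⟨V, E, hP⟩ : ∃ V E, (G.deleteEdges {e}).IsPathOn u v V E := by
      refine exists_isPathOn_of_cut (by simpa using he.left_mem) fun R hR huR hvR => ?_
      obtain ⟨e₁, a₁, b₁, e₂, a₂, b₂, hne, hl₁, ha₁, hb₁, hl₂, ha₂, hb₂⟩ :=
        h R (by simpa using hR) ⟨u, huR⟩ (fun h => hvR (h ▸ he.right_mem))
      by_cases he₁ : e₁ = e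
      · exact ⟨e₂, a₂, b₂, by simpa using ⟨hl₂, he₁ ▸ hne⟩, ha₂, hb₂⟩
      · exact ⟨e₁, a₁, b₁, by simpa using ⟨hl₁, he₁⟩, ha₁, hb₁⟩
    exact ⟨_, .of_isPathOn he hP, by simp, by simp⟩
  set R : Set α := {v | v = x ∨ ∃ L, G.IsChainList L ∧ (∃ C ∈ L.getLast?, x ∈ C.1) ∧
    ∃ C ∈ L.head?, v ∈ C.1} with hR
  by_contra hcon
  have hyR : y ∉ R := fun h => h.elim (fun h => hxy h.symm) hcon
  have hRV : R ⊆ V(G) := by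
    rintro v (rfl | ⟨L, hL, -, C, hC, hv⟩)
    · exact hx
    · exact (hL.isCircuitPair (List.mem_of_mem_head? hC)).subset hv
  obtain ⟨e, u, v, -, -, -, -, he, hu, hv, -⟩ := h R hRV ⟨x, Or.inl rfl⟩ (fun h => hyR (h ▸ hy))
  obtain ⟨K, hK, huK, hvK⟩ := key e u v he
  apply hv
  rcases hu with rfl | ⟨L, hL, hLx, C, hC, huC⟩
  · exact Or.inr ⟨[K], ⟨hK, trivial, by simp, by simp⟩, ⟨K, by simp, huK⟩, K, by simp, hvK⟩
  · exact Or.inr (hL.exists_extend hLx hK hvK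
      (fun D hD hvD => hv (Or.inr (hL.exists_suffix hLx hD hvD)))
      ⟨C, List.mem_of_mem_head? hC, Set.not_disjoint_iff.2 ⟨u, huC, huK⟩⟩)

lemma inter_getElem (hL : G.IsChainList L) (i : ℕ) (hi : i + 1 < L.length) :
    ∃ v, L[i].1 ∩ L[i + 1].1 = {v} := by
  induction L generalizing i with
  | nil => simp at hi
  | cons C L ih =>
    cases i with
    | zero =>
      cases L with
      | nil => simp at hi
      | cons D L => exact hL.2.2.1 D rfl
    | succ i => exact ih hL.2.1 i (by simpa using hi)

lemma disjoint_getElem (hL : G.IsChainList L) (i j : ℕ) (hij : i + 1 < j) (hj : j < L.length) :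
    Disjoint L[i].1 L[j].1 := by
  induction L generalizing i j with
  | nil => simp at hj
  | cons C L ih =>
    obtain ⟨j, rfl⟩ : ∃ j', j = j' + 1 := ⟨j - 1, by omega⟩
    cases i with
    | zero =>
      refine hL.2.2.2 _ ?_
      cases L with
      | nil => simp at hj
      | cons D L =>
        obtain ⟨j, rfl⟩ : ∃ j', j = j' + 1 := ⟨j - 1, by omega⟩
        simp
    | succ i => exact ih hL.2.1 i j (by omega) (by simpa using hj)

lemma exists_circuitChain [G.Loopless] (hL : G.IsChainList L) (hne : L ≠ []) :
    ∃ D : G.CircuitChain, D.vertices = ⋃ C ∈ L, C.1 ∧ D.edges = ⋃ C ∈ L, C.2 ∧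
      ∀ C ∈ L, ∃ i, C.2 = (D.circuit i).edgeSet := by
  have h : ∀ i : Fin L.length, ∃ H : Graph α β, H ≤ G ∧ H.IsCircuit ∧ V(H) = L[i].1 ∧
    E(H) = L[i].2 := fun i => (hL.isCircuitPair (List.getElem_mem _)).exists_isCircuit
  choose F h1 h2 h3 h4 using h
  refine ⟨⟨L.length, List.length_pos_iff.2 hne, F, h2, h1, ?_, ?_⟩, ?_, ?_, ?_⟩
  · intro i j hij
    obtain ⟨v, hv⟩ := hL.inter_getElem i (hij ▸ j.2)
    refine ⟨v, ?_⟩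
    rw [h3, h3, ← hv]
    simp only [hij, Fin.getElem_fin]
  · intro i j hij
    rw [h3, h3]
    exact hL.disjoint_getElem i j hij j.2
  · ext x
    simp only [CircuitChain.vertices, Set.mem_iUnion, h3, exists_prop, List.mem_iff_get]
    constructor
    · rintro ⟨i, hi⟩; exact ⟨_, ⟨i, rfl⟩, hi⟩
    · rintro ⟨_, ⟨i, rfl⟩, hi⟩; exact ⟨i, hi⟩
  · ext x
    simp only [CircuitChain.edges, Set.mem_iUnion, h4, exists_prop, List.mem_iff_get]
    constructor
    · rintro ⟨i, hi⟩; exact ⟨_, ⟨i, rfl⟩, hi⟩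
    · rintro ⟨_, ⟨i, rfl⟩, hi⟩; exact ⟨i, hi⟩
  · intro C hC
    obtain ⟨i, rfl⟩ := List.mem_iff_get.1 hC
    exact ⟨i, (h4 i).symm⟩

end IsChainList

end Chains

end Graph

namespace Graph

section Flows

variable {α β : Type*} {G : Graph α β}

/-- An orientation of the edges of a graph with finitely many edges. -/
structure FinOrientation (G : Graph α β) where
  tail : β → α
  head : β → α
  edges : Finset β
  mem_edges : ∀ e, e ∈ edges ↔ e ∈ E(G)
  isLink : ∀ e ∈ E(G), G.IsLink e (tail e) (head e)

namespace FinOrientation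

variable {A : Type*} [AddCommGroup A] (O : G.FinOrientation) {u v w x y : α} {e : β}
  {c c' : β → ℤ}

open Classical in
/-- The net outflow at `v`. -/
noncomputable def net (f : β → A) (v : α) : A :=
  ∑ e ∈ O.edges, ((if O.tail e = v then f e else 0) - (if O.head e = v then f e else 0))

open Classical in
/-- The value of `e` when it is oriented away from its end `v`. -/
noncomputable def out (f : β → A) (v : α) (e : β) : A :=
  if O.tail e = v then f e else -f e

lemma net_zero : O.net (0 : β → A) = 0 := by
  ext v; simp [net]

lemma net_add (f g : β → A) : O.net (f + g) = O.net f + O.net g := by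
  ext v
  simp only [net, Pi.add_apply, ← Finset.sum_add_distrib]
  refine Finset.sum_congr rfl fun e _ => ?_
  split_ifs <;> abel

lemma net_neg (f : β → A) : O.net (-f) = -O.net f := by
  rw [eq_neg_iff_add_eq_zero, ← net_add, neg_add_cancel, net_zero]

lemma net_sub (f g : β → A) : O.net (f - g) = O.net f - O.net g := by
  rw [sub_eq_add_neg, net_add, net_neg, sub_eq_add_neg]

lemma net_smul (c : β → ℤ) (a : A) (v : α) : O.net (fun e => c e • a) v = O.net c v • a := by
  simp only [net, Finset.sum_smul]
  refine Finset.sum_congr rfl fun e _ => ?_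
  split_ifs <;> simp

lemma net_smul_eq_zero (h : O.net c = 0) (a : A) : O.net (fun e => c e • a) = 0 := by
  ext v
  rw [net_smul, h]
  simp

lemma out_add_smul (f : β → A) (c : β → ℤ) (a : A) (v : α) (e : β) :
    O.out (fun e => f e + c e • a) v e = O.out f v e + O.out c v e • a := by
  simp only [out]
  split_ifs
  · rfl
  · rw [neg_smul]; abel

lemma inc_iff (he : e ∈ E(G)) : G.Inc e v ↔ v = O.tail e ∨ v = O.head e := by
  constructor
  · exact fun h => h.eq_or_eq_of_isLink (O.isLink e he)
  · rintro (rfl | rfl)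
    · exact (O.isLink e he).inc_left
    · exact (O.isLink e he).inc_right

lemma tail_eq_or (h : G.IsLink e u v) :
    (O.tail e = u ∧ O.head e = v) ∨ (O.tail e = v ∧ O.head e = u) :=
  (O.isLink e h.edge_mem).eq_and_eq_or_eq_and_eq h

lemma out_right [G.Loopless] (h : G.IsLink e u v) (f : β → A) : O.out f v e = -O.out f u e := by
  have hne := h.ne
  rcases O.tail_eq_or h with ⟨h1, -⟩ | ⟨h1, -⟩
  · simp [out, h1, hne]
  · simp [out, h1, hne.symm]

open Classical in
/-- The function `c` is supported in `F` and sends one unit from `u` to `v`. -/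
def Transfer (F : Set β) (u v : α) (c : β → ℤ) : Prop :=
  (∀ e ∉ F, c e = 0) ∧ O.net c = Pi.single u 1 - Pi.single v 1

namespace Transfer

variable {O}

lemma refl (F : Set β) (u : α) : O.Transfer F u u 0 :=
  ⟨fun _ _ => rfl, by rw [net_zero, sub_self]⟩

lemma mono {F F' : Set β} (h : O.Transfer F u v c) (hF : F ⊆ F') : O.Transfer F' u v c :=
  ⟨fun e he => h.1 e fun h => he (hF h), h.2⟩

lemma trans {F : Set β} (h : O.Transfer F u v c) (h' : O.Transfer F v w c') :
    O.Transfer F u w (c + c') :=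
  ⟨fun e he => by simp [h.1 e he, h'.1 e he], by rw [net_add, h.2, h'.2]; abel⟩

lemma symm {F : Set β} (h : O.Transfer F u v c) : O.Transfer F v u (-c) :=
  ⟨fun e he => by simp [h.1 e he], by rw [net_neg, h.2]; abel⟩

lemma net_eq_zero {F : Set β} (h : O.Transfer F u u c) : O.net c = 0 := by
  rw [h.2, sub_self]

end Transfer

lemma exists_transfer_of_isLink [G.Loopless] (h : G.IsLink e u v) :
    ∃ c, O.Transfer {e} u v c ∧ O.out c u e = 1 ∧ O.out c v e = -1 := by
  classical
  have hne := h.ne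
  have key : O.out (Pi.single e (if O.tail e = u then (1 : ℤ) else -1)) u e = 1 := by
    simp only [out, Pi.single_eq_same]
    split_ifs <;> simp
  refine ⟨Pi.single e (if O.tail e = u then 1 else -1), ⟨fun f hf => ?_, ?_⟩, key, ?_⟩
  · exact Pi.single_eq_of_ne hf _
  · ext w
    rw [net, Finset.sum_eq_single e]
    · rcases O.tail_eq_or h with ⟨h1, h2⟩ | ⟨h1, h2⟩
      · simp only [h1, h2, Pi.single_apply, Pi.sub_apply, if_true, @eq_comm _ w]
      · simp only [h1, h2, hne.symm, Pi.single_apply, Pi.sub_apply, if_true, if_false,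
          @eq_comm _ w]
        split_ifs <;> rfl
    · intro f _ hf
      simp [Pi.single_eq_of_ne hf]
    · exact fun h' => absurd ((O.mem_edges e).2 h.edge_mem) h'
  · rw [O.out_right h, key]

lemma unit_of_out {n : ℤ} (h : O.out c v e = n) (hn : n = 1 ∨ n = -1) : c e = 1 ∨ c e = -1 := by
  simp only [out] at h
  split_ifs at h <;> omega

lemma exists_transfer_of_isPathOn [G.Loopless] {V : Set α} {F : Set β}
    (h : G.IsPathOn u v V F) :
    ∃ c, O.Transfer F u v c ∧ ∀ e ∈ F, c e = 1 ∨ c e = -1 := by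
  induction h with
  | nil => exact ⟨0, .refl _ _, by simp⟩
  | @cons a b d e V F he h ha ih =>
    obtain ⟨c, hc, hcu⟩ := ih
    obtain ⟨c', hc', h1, h2⟩ := O.exists_transfer_of_isLink he
    have heF : e ∉ F := fun h' => ha (h.mem_of_isLink h' he)
    refine ⟨c' + c, (hc'.mono (by simp)).trans (hc.mono (Set.subset_insert _ _)), ?_⟩
    rintro f (rfl | hf)
    · simpa [hc.1 f heF] using O.unit_of_out h1 (Or.inl rfl)
    · have hfe : f ∉ ({e} : Set β) := fun h => heF (h ▸ hf)
      simpa [hc'.1 f hfe] using hcu f hf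

/-- A unit circulation around a circuit. -/
lemma exists_circulation [G.Loopless] {C : Set α × Set β} (h : G.IsCircuitPair C) :
    ∃ c : β → ℤ, O.net c = 0 ∧ (∀ e ∉ C.2, c e = 0) ∧ ∀ e ∈ C.2, c e = 1 ∨ c e = -1 := by
  obtain ⟨p, q, hpq, V₁, E₁, V₂, E₂, h1, h2, h3, h4, h5, h6⟩ := h
  obtain ⟨c₁, hc₁, hu₁⟩ := O.exists_transfer_of_isPathOn h1
  obtain ⟨c₂, hc₂, hu₂⟩ := O.exists_transfer_of_isPathOn h2
  rw [h6]
  refine ⟨c₁ - c₂, by rw [net_sub, hc₁.2, hc₂.2, sub_self], fun e he => ?_, ?_⟩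
  · simp [hc₁.1 e fun h => he (Or.inl h), hc₂.1 e fun h => he (Or.inr h)]
  · rintro e (he | he)
    · simpa [hc₂.1 e (Set.disjoint_left.1 h4 he)] using hu₁ e he
    · have := hu₂ e he
      simp only [Pi.sub_apply, hc₁.1 e (Set.disjoint_right.1 h4 he)]
      omega

lemma exists_transfer_of_isCircuitPair [G.Loopless] {C : Set α × Set β} (h : G.IsCircuitPair C)
    (hu : u ∈ C.1) (hv : v ∈ C.1) : ∃ c, O.Transfer C.2 u v c := by
  by_cases huv : u = v
  · exact huv ▸ ⟨0, .refl _ _⟩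
  · obtain ⟨-, V₁, E₁, V₂, E₂, h1, h2, h3, h4, h5, h6⟩ := h.isTheta hu hv huv
    obtain ⟨c, hc, -⟩ := O.exists_transfer_of_isPathOn h1
    exact ⟨c, hc.mono (h6 ▸ Set.subset_union_left)⟩

/-- The edges of a list of circuits. -/
def listEdges (L : List (Set α × Set β)) : Set β := {e | ∃ C ∈ L, e ∈ C.2}

/-- The vertices of a list of circuits. -/
def listVertices (L : List (Set α × Set β)) : Set α := {v | ∃ C ∈ L, v ∈ C.1}

lemma listEdges_cons (C : Set α × Set β) (L : List (Set α × Set β)) :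
    listEdges (C :: L) = C.2 ∪ listEdges L := by
  ext e; simp [listEdges]

lemma exists_transfer_of_isChainList [G.Loopless] {L : List (Set α × Set β)}
    (hL : G.IsChainList L) (hu : u ∈ listVertices L) (hv : v ∈ listVertices L) :
    ∃ c, O.Transfer (listEdges L) u v c := by
  induction L generalizing u v with
  | nil => obtain ⟨C, hC, -⟩ := hu; simp at hC
  | cons C L ih =>
    rw [listEdges_cons]
    have key : ∀ u ∈ C.1, ∀ v ∈ listVertices L, ∃ c, O.Transfer (C.2 ∪ listEdges L) u v c := by
      intro a ha b hb
      cases L with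
      | nil => obtain ⟨C, hC, -⟩ := hb; simp at hC
      | cons D L =>
        obtain ⟨p, hp⟩ := hL.2.2.1 D rfl
        have hpC : p ∈ C.1 ∩ D.1 := hp ▸ rfl
        obtain ⟨c, hc⟩ := O.exists_transfer_of_isCircuitPair hL.1 ha hpC.1
        obtain ⟨c', hc'⟩ := ih hL.2.1 ⟨D, by simp, hpC.2⟩ hb
        exact ⟨_, (hc.mono Set.subset_union_left).trans (hc'.mono Set.subset_union_right)⟩
    obtain ⟨D, hD, hu⟩ := hu
    obtain ⟨D', hD', hv⟩ := hv
    rcases List.mem_cons.1 hD with h1 | h1 <;> rcases List.mem_cons.1 hD' with h2 | h2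
    · obtain ⟨c, hc⟩ := O.exists_transfer_of_isCircuitPair hL.1 (h1 ▸ hu) (h2 ▸ hv)
      exact ⟨c, hc.mono Set.subset_union_left⟩
    · exact key u (h1 ▸ hu) v ⟨D', h2, hv⟩
    · obtain ⟨c, hc⟩ := key v (h2 ▸ hv) u ⟨D, h1, hu⟩
      exact ⟨_, hc.symm⟩
    · obtain ⟨c, hc⟩ := ih hL.2.1 ⟨D, h1, hu⟩ ⟨D', h2, hv⟩
      exact ⟨c, hc.mono Set.subset_union_right⟩

open Classical in
/-- The indicator function of a set of edges modulo two. -/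
noncomputable def parity (F : Set β) (e : β) : ZMod 2 := if e ∈ F then 1 else 0

lemma net_parity_union {F F' : Set β} (hd : Disjoint F F') (h : O.net (parity F) = 0)
    (h' : O.net (parity F') = 0) : O.net (parity (F ∪ F')) = 0 := by
  have : parity (F ∪ F') = parity F + parity F' := by
    ext e
    simp only [parity, Pi.add_apply, Set.mem_union]
    have : e ∈ F → e ∉ F' := fun h => Set.disjoint_left.1 hd h
    split_ifs <;> simp_all
  rw [this, net_add, h, h', add_zero]

lemma net_parity_circuit [G.Loopless] {C : Set α × Set β} (h : G.IsCircuitPair C) :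
    O.net (parity C.2) = 0 := by
  obtain ⟨c, h1, h2, h3⟩ := O.exists_circulation h
  have : parity C.2 = fun e => c e • (1 : ZMod 2) := by
    ext e
    simp only [parity]
    split_ifs with he
    · rcases h3 e he with h | h <;> rw [h] <;> decide
    · rw [h2 e he, zero_smul]
  rw [this, net_smul_eq_zero _ h1]

end FinOrientation

namespace IsChainList

open FinOrientation

variable {C D : Set α × Set β} {L : List (Set α × Set β)}

lemma inter_subsingleton (hL : G.IsChainList (C :: L)) (hD : D ∈ L) : (C.1 ∩ D.1).Subsingleton := by
  cases L with
  | nil => simp at hD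
  | cons B L =>
    rcases List.mem_cons.1 hD with rfl | hD
    · obtain ⟨v, hv⟩ := hL.2.2.1 D rfl
      rw [hv]; exact Set.subsingleton_singleton
    · have := hL.2.2.2 D hD
      rw [Set.disjoint_iff_inter_eq_empty.1 this]
      exact Set.subsingleton_empty

lemma disjoint_edges [G.Loopless] (hL : G.IsChainList (C :: L)) (hD : D ∈ L) :
    Disjoint C.2 D.2 := by
  rw [Set.disjoint_left]
  intro e heC heD
  obtain ⟨x, y, hl⟩ := exists_isLink_of_mem_edgeSet (hL.1.mem_edgeSet heC)
  have hDc := hL.2.1.isCircuitPair hD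
  exact hl.ne (hL.inter_subsingleton hD ⟨hL.1.mem_of_isLink heC hl, hDc.mem_of_isLink heD hl⟩
    ⟨hL.1.mem_of_isLink heC hl.symm, hDc.mem_of_isLink heD hl.symm⟩)

lemma net_parity [G.Loopless] (O : G.FinOrientation) (hL : G.IsChainList L) :
    O.net (parity (listEdges L)) = 0 := by
  induction L with
  | nil =>
    have : parity (listEdges ([] : List (Set α × Set β))) = 0 := by
      ext e; simp [parity, listEdges]
    rw [this, net_zero]
  | cons C L ih =>
    rw [listEdges_cons]
    refine O.net_parity_union ?_ (O.net_parity_circuit hL.1) (ih hL.2.1)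
    rw [Set.disjoint_left]
    rintro e he ⟨D, hD, heD⟩
    exact Set.disjoint_left.1 (hL.disjoint_edges hD) he heD

end IsChainList

/-- The values of `f` on edges of different circuits of the list that share an end are neither
equal nor opposite. -/
def Separates {A : Type*} [AddCommGroup A] (G : Graph α β) (f : β → A)
    (L : List (Set α × Set β)) : Prop :=
  ∀ C ∈ L, ∀ D ∈ L, C ≠ D → ∀ e ∈ C.2, ∀ e' ∈ D.2, ∀ v, G.Inc e v → G.Inc e' v →
    f e ≠ f e' ∧ f e ≠ -f e'

lemma Separates.congr {A : Type*} [AddCommGroup A] {f g : β → A} {L : List (Set α × Set β)}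
    (h : G.Separates f L) (hfg : ∀ C ∈ L, ∀ e ∈ C.2, g e = f e) : G.Separates g L := by
  intro C hC D hD hCD e he e' he' v hv hv'
  rw [hfg C hC e he, hfg D hD e' he']
  exact h C hC D hD hCD e he e' he' v hv hv'

open FinOrientation in
lemma IsChainList.exists_separates [G.Loopless] (O : G.FinOrientation) {k : ℕ} [NeZero k]
    (hk : 8 < k) {L : List (Set α × Set β)} (hL : G.IsChainList L) (f : β → ZMod k) :
    ∃ g : β → ZMod k, O.net g = 0 ∧ (∀ e ∉ listEdges L, g e = 0) ∧ G.Separates (f + g) L := by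
  classical
  induction L with
  | nil => exact ⟨0, O.net_zero, by simp, fun C hC => by simp at hC⟩
  | cons C L ih =>
    obtain ⟨g, hg0, hgs, hgS⟩ := ih hL.2.1
    obtain ⟨c, hc0, hcs, hcu⟩ := O.exists_circulation hL.1
    have main : ∃ a : ZMod k, ∀ D ∈ L, ∀ e ∈ C.2, ∀ e' ∈ D.2, ∀ v, G.Inc e v → G.Inc e' v →
        (f + g) e + c e • a ≠ (f + g) e' ∧ (f + g) e + c e • a ≠ -(f + g) e' := by
      cases L with
      | nil => exact ⟨0, by simp⟩
      | cons D L =>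
        obtain ⟨p, hp⟩ := hL.2.2.1 D rfl
        have hpC : p ∈ C.1 ∩ D.1 := hp ▸ rfl
        obtain ⟨e₁, -, e₂, -, -, he⟩ := hL.1.exists_pair hpC.1
        obtain ⟨d₁, -, d₂, -, -, hd⟩ := hL.2.1.1.exists_pair hpC.2
        set B : Finset (ZMod k) := (({e₁, e₂} : Finset β) ×ˢ (({d₁, d₂} : Finset β) ×ˢ
          ({1, -1} : Finset ℤ))).image
            (fun t => c t.1 • (t.2.2 • (f + g) t.2.1 - (f + g) t.1)) with hB
        have hBc : B.card < (Finset.univ : Finset (ZMod k)).card := by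
          rw [Finset.card_univ, ZMod.card]
          refine lt_of_le_of_lt (Finset.card_image_le.trans ?_) hk
          rw [Finset.card_product, Finset.card_product]
          exact Nat.mul_le_mul Finset.card_le_two
            (Nat.mul_le_mul Finset.card_le_two Finset.card_le_two)
        obtain ⟨a, -, ha⟩ := Finset.exists_mem_notMem_of_card_lt_card hBc
        refine ⟨a, fun D' hD' e heC e' heD v hv hv' => ?_⟩
        have hvC := hL.1.mem_of_inc heC hv
        have hvD := (hL.2.1.isCircuitPair hD').mem_of_inc heD hv'
        rcases List.mem_cons.1 hD' with rfl | hD'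
        · obtain rfl : v = p := by
            have : v ∈ C.1 ∩ D'.1 := ⟨hvC, hvD⟩
            rwa [hp] at this
          have h1 := (he e heC).1 hv
          have h2 := (hd e' heD).1 hv'
          have key : ∀ s : ℤ, (s = 1 ∨ s = -1) → (f + g) e + c e • a ≠ s • (f + g) e' := by
            intro s hs heq
            apply ha
            rw [hB, Finset.mem_image]
            refine ⟨(e, e', s), by simp [h1, h2, hs], ?_⟩
            simp only [← heq, add_sub_cancel_left]
            rw [← mul_smul]
            rcases hcu e heC with h | h <;> simp [h]
          exact ⟨by simpa using key 1 (Or.inl rfl), fun h => key (-1) (Or.inr rfl) (by rw [h, neg_one_smul])⟩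
        · exact absurd hvD (Set.disjoint_left.1 (hL.2.2.2 D' hD') hvC)
    obtain ⟨a, ha⟩ := main
    have hLv : ∀ D ∈ L, ∀ e ∈ D.2, c e = 0 := fun D hD e he =>
      hcs e (Set.disjoint_right.1 (hL.disjoint_edges hD) he)
    have hval : ∀ e, (f + (g + fun e => c e • a)) e = (f + g) e + c e • a := by
      intro e; simp [add_assoc]
    have hval' : ∀ D ∈ L, ∀ e ∈ D.2, (f + (g + fun e => c e • a)) e = (f + g) e := by
      intro D hD e he
      rw [hval, hLv D hD e he, zero_smul, add_zero]
    refine ⟨g + fun e => c e • a, by rw [net_add, hg0, net_smul_eq_zero _ hc0, add_zero], ?_, ?_⟩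
    · intro e he
      rw [listEdges_cons] at he
      simp [hgs e fun h => he (Or.inr h), hcs e fun h => he (Or.inl h)]
    · intro D hD D' hD' hne e he e' he' v hv hv'
      rcases List.mem_cons.1 hD with h1 | h1 <;> rcases List.mem_cons.1 hD' with h2 | h2
      · exact absurd (h1.trans h2.symm) hne
      · rw [hval e, hval' D' h2 e' he']
        exact ha D' h2 e (h1 ▸ he) e' he' v hv hv'
      · rw [hval e', hval' D h1 e he]
        obtain ⟨h3, h4⟩ := ha D h1 e' (h2 ▸ he') e he v hv' hv
        exact ⟨h3.symm, fun h => h4 (by rw [h, neg_neg])⟩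
      · rw [hval' D h1 e he, hval' D' h2 e' he']
        exact hgS D h1 D' h2 hne e he e' he' v hv hv'

open Classical in
/-- A circulation that takes the values `±1` on at most two edges and leaves them at common ends
with opposite signs can be scaled such that, after adding it to `f`, these edges have nonzero values
that differ from those of the edges in `N` leaving the same vertex. -/
lemma FinOrientation.exists_scale (O : G.FinOrientation) {k Δ : ℕ} [NeZero k]
    (hk : 4 * Δ - 2 < k) (hΔ : 1 ≤ Δ) {half : ZMod k} (hhalf : half * 2 = 1)
    (hdeg : ∀ v, (O.edges.filter fun e => G.Inc e v).card ≤ Δ)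
    {T : Finset β} (hT : T.card ≤ 2) (hTE : ∀ e ∈ T, e ∈ E(G)) {N : Set β} (hN : N ⊆ E(G))
    {c : β → ℤ} (hcT : ∀ e ∈ T, c e = 1 ∨ c e = -1) (hcN : ∀ e ∈ N, e ∉ T → c e = 0)
    (hopp : ∀ e ∈ T, ∀ e' ∈ T, e ≠ e' → ∀ v, G.Inc e v → G.Inc e' v →
      O.out c v e = -O.out c v e')
    (f : β → ZMod k) :
    ∃ a : ZMod k, ∀ e ∈ T, f e + c e • a ≠ 0 ∧ ∀ v, ∀ e' ∈ N, e' ≠ e → G.Inc e v → G.Inc e' v →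
      O.out (fun e => f e + c e • a) v e ≠ O.out (fun e => f e + c e • a) v e' := by
  set b : β → α → β → ZMod k := fun e v e' =>
    (if e' ∈ T then half else 1) * (O.out c v e • (O.out f v e' - O.out f v e)) with hb
  set I : β → α → Finset β := fun e v => (O.edges.filter fun e => G.Inc e v).erase e with hI
  set B : Finset (ZMod k) := T.biUnion fun e => insert (-(c e • f e))
    ((I e (O.tail e)).image (b e (O.tail e)) ∪ (I e (O.head e)).image (b e (O.head e))) with hB
  have hIc : ∀ e ∈ T, ∀ v, G.Inc e v → (I e v).card ≤ Δ - 1 := by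
    intro e he v hv
    rw [hI, Finset.card_erase_of_mem (by simpa [O.mem_edges] using ⟨hTE e he, hv⟩)]
    exact Nat.sub_le_sub_right (hdeg v) 1
  have hBc : B.card < (Finset.univ : Finset (ZMod k)).card := by
    rw [Finset.card_univ, ZMod.card]
    refine lt_of_le_of_lt ?_ hk
    refine (Finset.card_biUnion_le_card_mul T _ (2 * Δ - 1) fun e he => ?_).trans ?_
    · refine (Finset.card_insert_le _ _).trans ?_
      have h1 := hIc e he _ (O.isLink e (hTE e he)).inc_left
      have h2 := hIc e he _ (O.isLink e (hTE e he)).inc_right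
      have h3 := (Finset.card_union_le ((I e (O.tail e)).image (b e (O.tail e)))
        ((I e (O.head e)).image (b e (O.head e)))).trans
        (add_le_add (Finset.card_image_le.trans h1) (Finset.card_image_le.trans h2))
      omega
    · refine (Nat.mul_le_mul_right _ hT).trans ?_
      omega
  obtain ⟨a, -, ha⟩ := Finset.exists_mem_notMem_of_card_lt_card hBc
  refine ⟨a, fun e he => ⟨fun h0 => ha ?_, fun v e' he' hne hv hv' heq => ha ?_⟩⟩
  · refine Finset.mem_biUnion.2 ⟨e, he, Finset.mem_insert.2 (Or.inl ?_)⟩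
    rw [eq_neg_of_add_eq_zero_left h0, smul_neg, neg_neg, ← mul_smul]
    rcases hcT e he with h | h <;> simp [h]
  · refine Finset.mem_biUnion.2 ⟨e, he, Finset.mem_insert.2 (Or.inr ?_)⟩
    have hmem : e' ∈ I e v := by
      simpa [hI, O.mem_edges] using ⟨hne, hN he', hv'⟩
    have hba : b e v e' = a := by
      have hs : O.out c v e = 1 ∨ O.out c v e = -1 := by
        simp only [out]; have := hcT e he; split_ifs <;> omega
      rw [out_add_smul, out_add_smul] at heq
      simp only [hb]
      split_ifs with hT'
      · have := hopp e he e' hT' hne.symm v hv hv'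
        have h2 : O.out c v e' = -O.out c v e := by rw [this, neg_neg]
        rw [h2] at heq
        have h3 : O.out f v e' - O.out f v e = 2 * (O.out c v e • a) := by
          rw [neg_smul] at heq
          linear_combination (-1 : ZMod k) * heq
        rw [h3]
        rcases hs with h | h <;> rw [h]
        · linear_combination a * hhalf
        · linear_combination a * hhalf
      · have h2 : O.out c v e' = 0 := by simp [out, hcN e' he' hT']
        rw [h2, zero_smul, add_zero] at heq
        rw [← heq, add_sub_cancel_left, ← mul_smul]
        rcases hs with h | h <;> simp [h]
    rcases (O.inc_iff (hTE e he)).1 hv with rfl | rfl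
    · exact Finset.mem_union_left _ (Finset.mem_image.2 ⟨e', hmem, hba⟩)
    · exact Finset.mem_union_right _ (Finset.mem_image.2 ⟨e', hmem, hba⟩)

end Flows

end Graph

namespace Graph

open FinOrientation

section Growth

variable {α β : Type*} {G : Graph α β}

/-- The edges of the circuits in a list of lists of circuits. -/
def chainsEdges (𝒟 : List (List (Set α × Set β))) : Set β := {e | ∃ L ∈ 𝒟, e ∈ listEdges L}

lemma chainsEdges_append (𝒟 𝒟' : List (List (Set α × Set β))) :
    chainsEdges (𝒟 ++ 𝒟') = chainsEdges 𝒟 ∪ chainsEdges 𝒟' := by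
  ext e
  simp only [chainsEdges, Set.mem_union, Set.mem_ofPred_eq, List.mem_append]
  grind

/-- A list of vertex-disjoint circuit chains with vertices in `S`. -/
structure IsChainSystem (O : G.FinOrientation) (S : Set α) (𝒟 : List (List (Set α × Set β))) :
    Prop where
  isChainList : ∀ L ∈ 𝒟, G.IsChainList L ∧ L ≠ []
  subset : ∀ L ∈ 𝒟, listVertices L ⊆ S
  pairwise : 𝒟.Pairwise fun L L' => Disjoint (listVertices L) (listVertices L')
  net_parity : O.net (parity (chainsEdges 𝒟)) = 0

namespace IsChainSystem

variable {O : G.FinOrientation} {S W : Set α} {𝒟 𝒟' : List (List (Set α × Set β))} {x y : α}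
  {e : β}

lemma nil : IsChainSystem O S [] :=
  ⟨by simp, by simp, by simp, by
    have : parity (chainsEdges ([] : List (List (Set α × Set β)))) = 0 := by
      ext e; simp [parity, chainsEdges]
    rw [this, net_zero]⟩

lemma singleton [G.Loopless] {L : List (Set α × Set β)} (hL : G.IsChainList L) (hne : L ≠ []) :
    IsChainSystem O (listVertices L) [L] :=
  ⟨by simpa using ⟨hL, hne⟩, by simp, by simp, by
    have : chainsEdges [L] = listEdges L := by ext e; simp [chainsEdges]
    rw [this, hL.net_parity]⟩

lemma mem_of_isLink (h : IsChainSystem O S 𝒟) (he : e ∈ chainsEdges 𝒟) (hl : G.IsLink e x y) :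
    x ∈ S := by
  obtain ⟨L, hL, C, hC, heC⟩ := he
  exact h.subset L hL ⟨C, hC, ((h.isChainList L hL).1.isCircuitPair hC).mem_of_isLink heC hl⟩

lemma mem_edgeSet (h : IsChainSystem O S 𝒟) (he : e ∈ chainsEdges 𝒟) : e ∈ E(G) := by
  obtain ⟨L, hL, C, hC, heC⟩ := he
  exact ((h.isChainList L hL).1.isCircuitPair hC).mem_edgeSet heC

lemma append (h : IsChainSystem O S 𝒟) (h' : IsChainSystem O W 𝒟') (hd : Disjoint S W) :
    IsChainSystem O (S ∪ W) (𝒟 ++ 𝒟') where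
  isChainList L hL := (List.mem_append.1 hL).elim (h.isChainList L) (h'.isChainList L)
  subset L hL := (List.mem_append.1 hL).elim
    (fun hL => (h.subset L hL).trans Set.subset_union_left)
    (fun hL => (h'.subset L hL).trans Set.subset_union_right)
  pairwise := List.pairwise_append.2 ⟨h.pairwise, h'.pairwise, fun L hL L' hL' =>
    hd.mono (h.subset L hL) (h'.subset L' hL')⟩
  net_parity := by
    rw [chainsEdges_append]
    refine O.net_parity_union ?_ h.net_parity h'.net_parity
    rw [Set.disjoint_left]
    intro e he he'
    obtain ⟨x, y, hl⟩ := exists_isLink_of_mem_edgeSet (h.mem_edgeSet he)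
    exact Set.disjoint_left.1 hd (h.mem_of_isLink he hl) (h'.mem_of_isLink he' hl)

end IsChainSystem

/-- The requirements on the first coordinate `f` of the flow, as far as they concern an edge in
`X`, with chains `𝒟`, where `e₀` has the prescribed value `a`. -/
structure IsGood (O : G.FinOrientation) {k : ℕ} (e₀ : β) (a : ZMod k) (X : Set β)
    (𝒟 : List (List (Set α × Set β))) (f : β → ZMod k) : Prop where
  value : e₀ ∈ X → f e₀ = a
  ne_zero : ∀ e ∈ X, e ∉ chainsEdges 𝒟 → f e ≠ 0
  out_ne : ∀ e ∈ X, e ∉ chainsEdges 𝒟 → ∀ e' ∈ E(G), e' ∉ chainsEdges 𝒟 → e' ≠ e →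
    ∀ v, G.Inc e v → G.Inc e' v → O.out f v e ≠ O.out f v e'
  separates : ∀ L ∈ 𝒟, G.Separates f L

/-- A stage of the construction: vertices `S`, edges `X`, chains `𝒟`. -/
structure Stage (O : G.FinOrientation) {k : ℕ} (e₀ : β) (a : ZMod k) (S : Set α) (X : Set β)
    (𝒟 : List (List (Set α × Set β))) : Prop where
  subset : S ⊆ V(G)
  edge_mem : X ⊆ E(G)
  mem_of_isLink : ∀ e ∈ X, ∀ x y, G.IsLink e x y → x ∈ S
  transfer : ∀ u ∈ S, ∀ v ∈ S, ∃ c, O.Transfer X u v c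
  chains : IsChainSystem O S 𝒟
  chainsEdges_subset : chainsEdges 𝒟 ⊆ X
  flow : ∀ f : β → ZMod k, O.net f = 0 →
    ∃ g, O.net g = 0 ∧ (∀ e ∉ X, g e = 0) ∧ IsGood O e₀ a X 𝒟 (f + g)

lemma FinOrientation.out_congr (O : G.FinOrientation) {A : Type*} [AddCommGroup A] {f g : β → A}
    {e : β} (h : f e = g e) (v : α) : O.out f v e = O.out g v e := by
  simp only [out, h]

/-- The arithmetic assumptions on `k` and the vertex degrees. -/
structure IsLargeFor (O : G.FinOrientation) (k Δ : ℕ) : Prop where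
  lt : 4 * Δ - 2 < k
  le : 3 ≤ Δ
  half : ∃ half : ZMod k, half * 2 = 1
  card_le : ∀ v, {e ∈ E(G) | G.Inc e v}.ncard ≤ Δ

namespace Stage

variable {O : G.FinOrientation} {k Δ : ℕ} [NeZero k] {e₀ : β} {a : ZMod k} {S W : Set α}
  {X : Set β} {𝒟 𝒟' : List (List (Set α × Set β))} {x y u u' v w : α} {e e' : β}

/-- The common part of the two ways to enlarge a stage: new edges `T`, which are not chain edges,
and new chains `𝒟'`. -/
lemma flow_step [G.Loopless] (hk : IsLargeFor O k Δ) (h : Stage O e₀ a S X 𝒟)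
    (h' : IsChainSystem O W 𝒟') (hd : Disjoint S W) (he₀ : e₀ ∉ chainsEdges 𝒟')
    {T : Finset β} (hT : T.card ≤ 2) (hTE : ∀ e ∈ T, e ∈ E(G)) (hTX : ∀ e ∈ T, e ∉ X)
    (hTD : ∀ e ∈ T, e ∉ chainsEdges 𝒟') (hTe₀ : e₀ ∉ T)
    (hadj : ∀ f : β → ZMod k, ∃ g, O.net g = 0 ∧ (∀ e ∉ chainsEdges 𝒟', g e = 0) ∧
      ∀ L ∈ 𝒟', G.Separates (f + g) L)
    {c : β → ℤ} (hc : O.net c = 0) (hcs : ∀ e ∉ X ∪ chainsEdges 𝒟' ∪ T, c e = 0)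
    (hcT : ∀ e ∈ T, c e = 1 ∨ c e = -1)
    (hopp : ∀ e ∈ T, ∀ e' ∈ T, e ≠ e' → ∀ v, G.Inc e v → G.Inc e' v →
      O.out c v e = -O.out c v e') (f : β → ZMod k) (hf : O.net f = 0) :
    ∃ g, O.net g = 0 ∧ (∀ e ∉ X ∪ chainsEdges 𝒟' ∪ T, g e = 0) ∧
      IsGood O e₀ a (X ∪ chainsEdges 𝒟' ∪ T) (𝒟 ++ 𝒟') (f + g) := by
  classical
  obtain ⟨half, hhalf⟩ := hk.half
  have hdeg : ∀ v, (O.edges.filter fun e => G.Inc e v).card ≤ Δ := by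
    intro v
    rw [← Set.ncard_coe_finset]
    convert hk.card_le v using 2
    ext e; simp [O.mem_edges]
  have hXD : ∀ e ∈ X, e ∉ chainsEdges 𝒟' := by
    intro e he he'
    obtain ⟨x, y, hl⟩ := exists_isLink_of_mem_edgeSet (h.edge_mem he)
    exact Set.disjoint_left.1 hd (h.mem_of_isLink e he x y hl) (h'.mem_of_isLink he' hl)
  obtain ⟨t, ht⟩ := O.exists_scale hk.lt (by have := hk.le; omega) hhalf hdeg hT hTE
    (N := {e ∈ E(G) | e ∉ X ∧ e ∉ chainsEdges 𝒟'}) (fun e he => he.1) hcT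
    (fun e he heT => hcs e (by
      rintro ((h1 | h1) | h1)
      exacts [he.2.1 h1, he.2.2 h1, heT h1])) hopp f
  obtain ⟨g₁, hg₁, hg₁s, hg₁S⟩ := hadj fun e => f e + c e • t
  obtain ⟨g₂, hg₂, hg₂s, hg₂G⟩ := h.flow ((f + fun e => c e • t) + g₁)
    (by rw [net_add, net_add, hf, hg₁, net_smul_eq_zero _ hc]; simp)
  set g : β → ZMod k := (fun e => c e • t) + g₁ + g₂ with hg
  have hfg : f + g = f + (fun e => c e • t) + g₁ + g₂ := by rw [hg]; abel
  have hval : ∀ e, e ∉ X → e ∉ chainsEdges 𝒟' → (f + g) e = f e + c e • t := by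
    intro e h1 h2
    rw [hfg]
    simp [hg₁s e h2, hg₂s e h1]
  have key : ∀ e ∈ T, ∀ e' ∈ E(G), e' ∉ chainsEdges 𝒟' → e' ∉ X → e' ≠ e →
      ∀ v, G.Inc e v → G.Inc e' v → O.out (f + g) v e ≠ O.out (f + g) v e' := by
    intro e he e' he' heD' heX' hne v hv hv'
    rw [O.out_congr (g := fun e => f e + c e • t) (hval e (hTX e he) (hTD e he)),
      O.out_congr (g := fun e => f e + c e • t) (hval e' heX' heD')]
    exact (ht e he).2 v e' ⟨he', heX', heD'⟩ hne hv hv'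
  refine ⟨g, ?_, ?_, ?_, ?_, ?_, ?_⟩
  · rw [hg, net_add, net_add, hg₁, hg₂, net_smul_eq_zero _ hc]; simp
  · intro e he
    simp only [Set.mem_union, not_or] at he
    have := hcs e (by simpa [not_or] using he)
    simp [hg, this, hg₁s e he.1.2, hg₂s e he.1.1]
  · rintro ((h1 | h1) | h1)
    · rw [hfg]; exact hg₂G.value h1
    · exact absurd h1 he₀
    · exact absurd h1 hTe₀
  · rintro e ((h1 | h1) | h1) hD
    · rw [hfg]; exact hg₂G.ne_zero e h1 fun h2 => hD (by rw [chainsEdges_append]; exact Or.inl h2)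
    · exact absurd (by rw [chainsEdges_append]; exact Or.inr h1) hD
    · rw [hval e (hTX e h1) (hTD e h1)]
      exact (ht e h1).1
  · intro e he hD e' he' hD' hne v hv hv'
    rw [chainsEdges_append, Set.mem_union, not_or] at hD hD'
    rcases he with (h1 | h1) | h1
    · rw [hfg]; exact hg₂G.out_ne e h1 hD.1 e' he' hD'.1 hne v hv hv'
    · exact absurd h1 hD.2
    · by_cases heX : e' ∈ X
      · rw [hfg]
        exact (hg₂G.out_ne e' heX hD'.1 e (hTE e h1) hD.1 hne.symm v hv' hv).symm
      · exact key e h1 e' he' hD'.2 heX hne v hv hv'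
  · intro L hL
    rcases List.mem_append.1 hL with hL | hL
    · rw [hfg]; exact hg₂G.separates L hL
    · refine (hg₁S L hL).congr fun C hC e he => ?_
      have heX : e ∉ X := fun h1 => hXD e h1 ⟨L, hL, C, hC, he⟩
      rw [hfg]
      simp [hg₂s e heX]

/-- An edge joining two vertices of a stage can be added to it. -/
lemma add_edge [G.Loopless] (hk : IsLargeFor O k Δ) (h : Stage O e₀ a S X 𝒟)
    (hl : G.IsLink e u v) (hu : u ∈ S) (hv : v ∈ S) (heX : e ∉ X) (hee₀ : e ≠ e₀) :
    Stage O e₀ a S (X ∪ {e}) 𝒟 where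
  subset := h.subset
  edge_mem := Set.union_subset h.edge_mem (by simpa using hl.edge_mem)
  mem_of_isLink := by
    rintro f (hf | rfl) x y hl'
    · exact h.mem_of_isLink f hf x y hl'
    · rcases hl'.left_eq_or_eq hl with rfl | rfl <;> assumption
  transfer a ha b hb := by
    obtain ⟨c, hc⟩ := h.transfer a ha b hb
    exact ⟨c, hc.mono Set.subset_union_left⟩
  chains := h.chains
  chainsEdges_subset := h.chainsEdges_subset.trans Set.subset_union_left
  flow := by
    obtain ⟨c, hc⟩ := h.transfer v hv u hu
    obtain ⟨c', hc', h1, h2⟩ := O.exists_transfer_of_isLink hl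
    have h0 : chainsEdges ([] : List (List (Set α × Set β))) = ∅ := by simp [chainsEdges]
    have := h.flow_step (W := ∅) (𝒟' := []) hk IsChainSystem.nil (by simp) (by simp [h0])
      (T := {e}) (by simp) (by simpa using hl.edge_mem) (by simpa using heX) (by simp [h0])
      (by simpa using hee₀.symm) (fun f => ⟨0, O.net_zero, by simp, by simp⟩)
      (c := c' + c) (((hc'.mono (F' := X ∪ {e}) (by simp)).trans (hc.mono (by simp))).net_eq_zero)
      (by
        intro f hf
        simp only [h0, Set.union_empty, Finset.coe_singleton, Set.mem_union, not_or] at hf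
        simp [hc.1 f hf.1, hc'.1 f hf.2])
      (by
        simp only [Finset.mem_singleton, forall_eq, Pi.add_apply, hc.1 e heX, add_zero]
        exact O.unit_of_out h1 (Or.inl rfl))
      (by simp +contextual)
    simpa [h0] using this

/-- A set `W` of new vertices, connected by new chains, can be added to a stage together with two
edges from `W` to the stage. -/
lemma add_part [G.Loopless] (hk : IsLargeFor O k Δ) (h : Stage O e₀ a S X 𝒟)
    (h' : IsChainSystem O W 𝒟') (hW : W ⊆ V(G)) (hd : Disjoint S W) (he₀ : e₀ ∉ chainsEdges 𝒟')
    (hconn : ∀ x ∈ W, ∀ y ∈ W, ∃ c, O.Transfer (chainsEdges 𝒟') x y c)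
    (hadj : ∀ f : β → ZMod k, ∃ g, O.net g = 0 ∧ (∀ e ∉ chainsEdges 𝒟', g e = 0) ∧
      ∀ L ∈ 𝒟', G.Separates (f + g) L)
    (hl : G.IsLink e u x) (hl' : G.IsLink e' u' y) (hne : e ≠ e') (hu : u ∈ S) (hu' : u' ∈ S)
    (hx : x ∈ W) (hy : y ∈ W) (hee₀ : e ≠ e₀) (hee₀' : e' ≠ e₀) :
    Stage O e₀ a (S ∪ W) (X ∪ chainsEdges 𝒟' ∪ {e, e'}) (𝒟 ++ 𝒟') := by
  classical
  have hSW : ∀ z ∈ S, z ∉ W := fun z hz hz' => Set.disjoint_left.1 hd hz hz'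
  have heX : e ∉ X := fun hX => hSW x (h.mem_of_isLink e hX x u hl.symm) hx
  have heX' : e' ∉ X := fun hX => hSW y (h.mem_of_isLink e' hX y u' hl'.symm) hy
  have heD : e ∉ chainsEdges 𝒟' := fun hD => hSW u hu (h'.mem_of_isLink hD hl)
  have heD' : e' ∉ chainsEdges 𝒟' := fun hD => hSW u' hu' (h'.mem_of_isLink hD hl')
  obtain ⟨c₁, hc₁, ho₁, ho₂⟩ := O.exists_transfer_of_isLink hl
  obtain ⟨c₂, hc₂, ho₃, ho₄⟩ := O.exists_transfer_of_isLink hl'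
  obtain ⟨p, hp⟩ := h.transfer u' hu' u hu
  obtain ⟨q, hq⟩ := hconn x hx y hy
  set Y := X ∪ chainsEdges 𝒟' ∪ {e, e'} with hY
  have m1 : {e} ⊆ Y := by simp [hY]
  have m2 : {e'} ⊆ Y := by simp [hY]
  have m3 : X ⊆ Y := fun f hf => Or.inl (Or.inl hf)
  have m4 : chainsEdges 𝒟' ⊆ Y := fun f hf => Or.inl (Or.inr hf)
  have hc : O.Transfer Y u u (c₁ + q + -c₂ + p) :=
    (((hc₁.mono m1).trans (hq.mono m4)).trans (hc₂.mono m2).symm).trans (hp.mono m3)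
  have hce : (c₁ + q + -c₂ + p) e = c₁ e := by
    simp [hq.1 e heD, hc₂.1 e hne, hp.1 e heX]
  have hce' : (c₁ + q + -c₂ + p) e' = (-c₂) e' := by
    simp [hq.1 e' heD', hc₁.1 e' hne.symm, hp.1 e' heX']
  have hoe : ∀ v, O.out (c₁ + q + -c₂ + p) v e = O.out c₁ v e := O.out_congr hce
  have hoe' : ∀ v, O.out (c₁ + q + -c₂ + p) v e' = -O.out c₂ v e' := by
    intro v
    rw [O.out_congr hce']
    simp only [out, Pi.neg_apply]
    split_ifs <;> rfl
  have hopp : ∀ v, G.Inc e v → G.Inc e' v →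
      O.out (c₁ + q + -c₂ + p) v e = -O.out (c₁ + q + -c₂ + p) v e' := by
    intro v hv hv'
    rw [hoe, hoe', neg_neg]
    rcases hv.eq_or_eq_of_isLink hl with rfl | rfl <;>
      rcases hv'.eq_or_eq_of_isLink hl' with rfl | rfl
    · rw [ho₁, ho₃]
    · exact absurd hy (hSW _ hu)
    · exact absurd hx (hSW _ hu')
    · rw [ho₂, ho₄]
  have hSW' : ∀ x ∈ S ∪ W, ∃ c, O.Transfer Y x u c := by
    rintro z (hz | hz)
    · obtain ⟨c, hc⟩ := h.transfer z hz u hu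
      exact ⟨c, hc.mono m3⟩
    · obtain ⟨c, hc⟩ := hconn z hz x hx
      exact ⟨_, (hc.mono m4).trans (hc₁.mono m1).symm⟩
  refine ⟨Set.union_subset h.subset hW, ?_, ?_, ?_, h.chains.append h' hd, ?_, ?_⟩
  · rintro f ((hf | hf) | rfl | rfl)
    · exact h.edge_mem hf
    · exact h'.mem_edgeSet hf
    · exact hl.edge_mem
    · exact hl'.edge_mem
  · rintro f ((hf | hf) | rfl | rfl) a b hab
    · exact Or.inl (h.mem_of_isLink f hf a b hab)
    · exact Or.inr (h'.mem_of_isLink hf hab)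
    · rcases hab.left_eq_or_eq hl with rfl | rfl
      · exact Or.inl hu
      · exact Or.inr hx
    · rcases hab.left_eq_or_eq hl' with rfl | rfl
      · exact Or.inl hu'
      · exact Or.inr hy
  · intro a ha b hb
    obtain ⟨c, hc⟩ := hSW' a ha
    obtain ⟨c', hc'⟩ := hSW' b hb
    exact ⟨_, hc.trans hc'.symm⟩
  · rw [chainsEdges_append]
    exact Set.union_subset (h.chainsEdges_subset.trans m3) m4
  · have := h.flow_step hk h' hd he₀ (T := {e, e'}) Finset.card_le_two
      (by simpa using ⟨hl.edge_mem, hl'.edge_mem⟩) (by simpa using ⟨heX, heX'⟩)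
      (by simpa using ⟨heD, heD'⟩) (by simpa using ⟨hee₀.symm, hee₀'.symm⟩) hadj
      (c := c₁ + q + -c₂ + p) hc.net_eq_zero (fun f hf => hc.1 f (by simpa [hY] using hf))
      (by
        simp only [Finset.mem_insert, Finset.mem_singleton, forall_eq_or_imp, forall_eq, hce, hce']
        refine ⟨O.unit_of_out ho₁ (Or.inl rfl), ?_⟩
        have := O.unit_of_out ho₃ (Or.inl rfl)
        simp only [Pi.neg_apply]
        omega)
      (by
        simp only [Finset.mem_insert, Finset.mem_singleton]
        rintro f (rfl | rfl) f' (rfl | rfl) hff v hv hv'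
        · exact absurd rfl hff
        · exact hopp v hv hv'
        · rw [hopp v hv' hv, neg_neg]
        · exact absurd rfl hff)
    simpa [hY] using this

end Stage

end Growth

end Graph

namespace Graph

open FinOrientation

section Completion

variable {α β : Type*} {G H : Graph α β}

/-- Every nonempty vertex set avoiding `s` has at least two leaving edges, and three unless it
contains `t`. -/
def HasLargeCuts (H : Graph α β) (s t : α) : Prop :=
  ∀ Z ⊆ V(H), Z.Nonempty → s ∉ Z →
    (∀ e₁, ∃ e x y, e ≠ e₁ ∧ H.IsLink e x y ∧ x ∈ Z ∧ y ∉ Z) ∧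
    (t ∉ Z → ∀ e₁ e₂, ∃ e x y, e ≠ e₁ ∧ e ≠ e₂ ∧ H.IsLink e x y ∧ x ∈ Z ∧ y ∉ Z)

/-- A nonempty set `U` avoiding `s` contains a set which induces a graph without cuts of size less
than two and from which at least two edges leave `U`. -/
lemma HasLargeCuts.exists_leaf {s t : α} (hH : H.HasLargeCuts s t) (e₀ : β) {U : Set α}
    (hUf : U.Finite) (hU : U ⊆ V(H)) (hne : U.Nonempty) (hs : s ∉ U) :
    ∃ Z ⊆ U, (∀ R ⊆ Z, R.Nonempty → R ≠ Z → ∃ e u v e' u' v', e' ≠ e ∧ H.IsLink e u v ∧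
      u ∈ R ∧ v ∈ Z \ R ∧ H.IsLink e' u' v' ∧ u' ∈ R ∧ v' ∈ Z \ R) ∧
      ∃ e x u e' y u', e ≠ e' ∧ H.IsLink e x u ∧ H.IsLink e' y u' ∧ x ∈ Z ∧ y ∈ Z ∧
        u ∉ U ∧ u' ∉ U := by
  set P : Set (Set α) := {Z | Z ⊆ U ∧ Z.Nonempty ∧
    ((∀ e x y, H.IsLink e x y → x ∈ Z → y ∈ U → y ∈ Z) ∨
      (t ∉ Z ∧ ∃ h, ∀ e x y, H.IsLink e x y → x ∈ Z → y ∈ U → y ∉ Z → e = h))} with hP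
  have hPf : P.Finite := hUf.finite_subsets.subset fun Z hZ => hZ.1
  obtain ⟨Z, hZ⟩ := hPf.exists_minimal ⟨U, subset_rfl, hne, Or.inl fun _ _ _ _ _ h => h⟩
  obtain ⟨⟨hZU, hZne, hZP⟩, hmin⟩ := hZ
  have hZs : s ∉ Z := fun h => hs (hZU h)
  obtain ⟨hcut2, hcut3⟩ := hH Z (hZU.trans hU) hZne hZs
  refine ⟨Z, hZU, ?_, ?_⟩
  · intro R hR hRne hRZ
    by_contra hcon
    have huniq : ∀ e u v e' u' v', H.IsLink e u v → u ∈ R → v ∈ Z \ R → H.IsLink e' u' v' →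
        u' ∈ R → v' ∈ Z \ R → e' = e := by
      intro e u v e' u' v' h1 h2 h3 h4 h5 h6
      by_contra h7
      exact hcon ⟨e, u, v, e', u', v', h7, h1, h2, h3, h4, h5, h6⟩
    have claim : ∀ R₁ R₂ : Set α, R₁ ∪ R₂ = Z → Disjoint R₁ R₂ → R₁.Nonempty → R₂.Nonempty →
        (∀ e u v e' u' v', H.IsLink e u v → u ∈ R₁ → v ∈ R₂ → H.IsLink e' u' v' →
        u' ∈ R₁ → v' ∈ R₂ → e' = e) → t ∉ R₁ →
        (∀ e x y, H.IsLink e x y → x ∈ R₁ → y ∈ U → y ∈ Z) → False := by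
      intro R₁ R₂ hun hdis hne₁ hne₂ hu ht hno
      have hR₁Z : R₁ ⊆ Z := hun ▸ Set.subset_union_left
      have hR₁P : R₁ ∈ P := by
        refine ⟨hR₁Z.trans hZU, hne₁, ?_⟩
        by_cases hex : ∃ h u v, H.IsLink h u v ∧ u ∈ R₁ ∧ v ∈ R₂
        · obtain ⟨h, u, v, hl, hu1, hv2⟩ := hex
          refine Or.inr ⟨ht, h, fun e x y hxy hx hy hy1 => hu h u v e x y hl hu1 hv2 hxy hx ?_⟩
          have := hno e x y hxy hx hy
          rw [← hun] at this
          exact this.resolve_left hy1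
        · refine Or.inl fun e x y hxy hx hy => ?_
          by_contra hy1
          have := hno e x y hxy hx hy
          rw [← hun] at this
          exact hex ⟨e, x, y, hxy, hx, this.resolve_left hy1⟩
      obtain ⟨z, hz⟩ := hne₂
      exact Set.disjoint_left.1 hdis (hmin hR₁P hR₁Z (hun ▸ Or.inr hz)) hz
    have hun : R ∪ (Z \ R) = Z := Set.union_sdiff_cancel hR
    have hun' : (Z \ R) ∪ R = Z := by rw [Set.union_comm]; exact hun
    have hne' : (Z \ R).Nonempty := by
      rw [Set.sdiff_nonempty]
      exact fun h => hRZ (hR.antisymm h)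
    have hdis : Disjoint R (Z \ R) := Set.disjoint_sdiff_right
    have hR₁ := claim R (Z \ R) hun hdis hRne hne' huniq
    have hR₂ := claim (Z \ R) R hun' hdis.symm hne' hRne
      (fun e u v e' u' v' h1 h2 h3 h4 h5 h6 => huniq e v u e' v' u' h1.symm h3 h2 h4.symm h6 h5)
    rcases hZP with hZP | ⟨htZ, h, hh⟩
    · by_cases ht : t ∈ R
      · exact hR₂ (fun h => h.2 ht) fun e x y hl hx hy => hZP e x y hl hx.1 hy
      · exact hR₁ ht fun e x y hl hx hy => hZP e x y hl (hR hx) hy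
    · refine hR₁ (fun h => htZ (hR h)) fun e x y hl hx hy => ?_
      by_contra hyZ
      obtain rfl := hh e x y hl (hR hx) hy hyZ
      refine hR₂ (fun h => htZ h.1) fun e' x' y' hl' hx' hy' => ?_
      by_contra hyZ'
      obtain rfl := hh e' x' y' hl' hx'.1 hy' hyZ'
      rcases hl'.left_eq_or_eq hl with rfl | rfl
      · exact hx'.2 hx
      · exact hyZ hx'.1
  · rcases hZP with hZP | ⟨htZ, h, hh⟩
    · obtain ⟨e, x, u, -, hl, hx, hu⟩ := hcut2 e₀
      obtain ⟨e', y, u', hne, hl', hy, hu'⟩ := hcut2 e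
      exact ⟨e, x, u, e', y, u', hne.symm, hl, hl', hx, hy, fun h => hu (hZP _ _ _ hl hx h),
        fun h => hu' (hZP _ _ _ hl' hy h)⟩
    · obtain ⟨e, x, u, he, -, hl, hx, hu⟩ := hcut3 htZ h h
      obtain ⟨e', y, u', he', hne, hl', hy, hu'⟩ := hcut3 htZ h e
      exact ⟨e, x, u, e', y, u', hne.symm, hl, hl', hx, hy, fun h => he (hh _ _ _ hl hx h hu),
        fun h => he' (hh _ _ _ hl' hy h hu')⟩

namespace Stage

variable {O : G.FinOrientation} {k Δ : ℕ} [NeZero k] {e₀ : β} {a : ZMod k} {S : Set α}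
  {X : Set β} {𝒟 : List (List (Set α × Set β))} {s t : α}

/-- A stage that does not contain all edges of `H` can be enlarged. -/
lemma exists_larger [G.Loopless] (hk : IsLargeFor O k Δ) (h8 : 8 < k) (hV : V(G).Finite)
    (hHG : H ≤ G) (hVH : V(H) = V(G)) (hH : H.HasLargeCuts s t) (h : Stage O e₀ a S X 𝒟)
    (hs : s ∈ S) (he₀ : e₀ ∈ X ∨ e₀ ∉ E(H)) (hX : ¬ E(H) ⊆ X) :
    ∃ S' X' 𝒟', Stage O e₀ a S' X' 𝒟' ∧ s ∈ S' ∧ X ⊆ X' ∧ (e₀ ∈ X' → e₀ ∈ X) ∧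
      chainsEdges 𝒟 ⊆ chainsEdges 𝒟' ∧ ∃ e ∈ E(H), e ∈ X' ∧ e ∉ X := by
  have hnew : ∀ e ∈ E(H), e ∉ X → e ≠ e₀ := by
    rintro e heH heX rfl
    exact he₀.elim heX fun h => h heH
  have hnS : ∀ {e x y}, G.IsLink e x y → x ∉ S → e ∉ X := fun hl hx heX =>
    hx (h.mem_of_isLink _ heX _ _ hl)
  obtain ⟨e₁, he₁H, he₁X⟩ := Set.not_subset.1 hX
  by_cases hU : V(G) \ S = ∅
  · have hVS : V(G) ⊆ S := Set.sdiff_eq_empty.1 hU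
    obtain ⟨u, v, hl⟩ := exists_isLink_of_mem_edgeSet he₁H
    have hl' := hl.mono hHG
    exact ⟨S, _, 𝒟, h.add_edge hk hl' (hVS hl'.left_mem) (hVS hl'.right_mem) he₁X
      (hnew e₁ he₁H he₁X), hs, Set.subset_union_left,
      fun h => h.resolve_right (hnew e₁ he₁H he₁X).symm, subset_rfl, e₁, he₁H, Or.inr rfl, he₁X⟩
  obtain ⟨Z, hZU, hZ, e, x, u, e', y, u', hne, hl, hl', hx, hy, hu, hu'⟩ :=
    hH.exists_leaf e₀ (hV.subset Set.sdiff_subset) (hVH ▸ Set.sdiff_subset)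
      (Set.nonempty_iff_ne_empty.2 hU) (fun h => h.2 hs)
  have huS : u ∈ S := by
    by_contra h'
    exact hu ⟨(hl.mono hHG).right_mem, h'⟩
  have huS' : u' ∈ S := by
    by_contra h'
    exact hu' ⟨(hl'.mono hHG).right_mem, h'⟩
  have hxS : x ∉ S := (hZU hx).2
  have hyS : y ∉ S := (hZU hy).2
  have heX : e ∉ X := hnS (hl.mono hHG) hxS
  have heX' : e' ∉ X := hnS (hl'.mono hHG) hyS
  have hee₀ := hnew e hl.edge_mem heX
  have hee₀' := hnew e' hl'.edge_mem heX'
  by_cases hxy : x = y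
  · subst hxy
    have h0 : chainsEdges ([] : List (List (Set α × Set β))) = ∅ := by simp [chainsEdges]
    refine ⟨_, _, _, h.add_part hk (W := {x}) (𝒟' := []) ⟨by simp, by simp, by simp, ?_⟩ ?_ ?_ ?_
      ?_ ?_ (hl.mono hHG).symm (hl'.mono hHG).symm hne huS huS' rfl rfl hee₀ hee₀', Or.inl hs,
      fun f hf => Or.inl (Or.inl hf), ?_,
      by rw [chainsEdges_append]; exact Set.subset_union_left, e, hl.edge_mem, Or.inr (Or.inl rfl), heX⟩
    · exact IsChainSystem.nil (S := (∅ : Set α)).net_parity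
    · simpa using (hl.mono hHG).left_mem
    · simpa using hxS
    · simp [h0]
    · rintro _ rfl _ rfl
      exact ⟨0, .refl _ _⟩
    · exact fun f => ⟨0, O.net_zero, by simp, by simp⟩
    · rintro ((h | h) | h | h)
      exacts [h, absurd h (by simp [h0]), absurd h.symm hee₀, absurd h.symm hee₀']
  · have hZV : Z ⊆ V(H) := fun z hz => hVH ▸ (hZU hz).1
    have hKH : H.induce Z ≤ H := induce_le hZV
    have : (H.induce Z).Loopless := Loopless.anti (hKH.trans hHG)
    obtain ⟨L, hL, ⟨C, hC, hxC⟩, D, hD, hyD⟩ := IsChainList.exists_of_cut (G := H.induce Z) hxy hx hy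
      (by
        intro R hR hRne hRZ
        obtain ⟨e, u, v, e', u', v', h1, h2, h3, h4, h5, h6, h7⟩ := hZ R hR hRne hRZ
        exact ⟨e, u, v, e', u', v', h1, ⟨h2, hR h3, h4.1⟩, h3, h4.2, ⟨h5, hR h6, h7.1⟩, h6, h7.2⟩)
    have hLG := hL.mono (hKH.trans hHG)
    have hLne : L ≠ [] := by rintro rfl; simp at hC
    have hLZ : listVertices L ⊆ Z := by
      rintro v ⟨C, hC, hv⟩
      exact (hL.isCircuitPair hC).subset hv
    have h0 : chainsEdges [L] = listEdges L := by ext e; simp [chainsEdges]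
    have he₀L : e₀ ∉ chainsEdges [L] := by
      rw [h0]
      rintro ⟨C, hC, he⟩
      have hCK := hL.isCircuitPair hC
      have heK := hCK.mem_edgeSet he
      obtain ⟨p, q, hpq⟩ := exists_isLink_of_mem_edgeSet heK
      have hp := hCK.mem_of_isLink he hpq
      exact hnew e₀ (hKH.edgeSet_mono heK)
        (hnS (hpq.mono (hKH.trans hHG)) (hZU (hLZ ⟨C, hC, hp⟩)).2) rfl
    refine ⟨_, _, _, h.add_part hk (IsChainSystem.singleton hLG hLne) ?_ ?_ he₀L ?_ ?_
      (hl.mono hHG).symm (hl'.mono hHG).symm hne huS huS'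
      ⟨C, List.mem_of_getLast? hC, hxC⟩ ⟨D, List.mem_of_mem_head? hD, hyD⟩ hee₀ hee₀', Or.inl hs,
      fun f hf => Or.inl (Or.inl hf), ?_,
      by rw [chainsEdges_append]; exact Set.subset_union_left, e, hl.edge_mem, Or.inr (Or.inl rfl), heX⟩
    · exact fun v hv => (hZU (hLZ hv)).1
    · exact Set.disjoint_left.2 fun v hv hv' => (hZU (hLZ hv')).2 hv
    · rw [h0]
      exact fun p hp q hq => O.exists_transfer_of_isChainList hLG hp hq
    · rw [h0]
      intro f
      obtain ⟨g, h1, h2, h3⟩ := hLG.exists_separates O h8 f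
      exact ⟨g, h1, h2, by simpa using h3⟩
    · rintro ((h | h) | h | h)
      exacts [h, absurd h he₀L, absurd h.symm hee₀, absurd h.symm hee₀']

lemma exists_complete [G.Loopless] (hk : IsLargeFor O k Δ) (h8 : 8 < k) (hV : V(G).Finite)
    (hE : E(G).Finite) (hHG : H ≤ G) (hVH : V(H) = V(G)) (hH : H.HasLargeCuts s t)
    (h : Stage O e₀ a S X 𝒟) (hs : s ∈ S) (he₀ : e₀ ∈ X ∨ e₀ ∉ E(H)) :
    ∃ S' X' 𝒟', Stage O e₀ a S' X' 𝒟' ∧ (e₀ ∈ X' → e₀ ∈ X) ∧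
      chainsEdges 𝒟 ⊆ chainsEdges 𝒟' ∧ E(H) ⊆ X' := by
  induction hn : (E(H) \ X).ncard using Nat.strong_induction_on generalizing S X 𝒟 with
  | _ n ih =>
    by_cases hX : E(H) ⊆ X
    · exact ⟨S, X, 𝒟, h, id, subset_rfl, hX⟩
    · obtain ⟨S', X', 𝒟', h', hs', hXX, heX₀, hDD, e, heH, heX', heX⟩ :=
        h.exists_larger hk h8 hV hHG hVH hH hs he₀ hX
      have hlt : (E(H) \ X').ncard < n := by
        rw [← hn]
        refine Set.ncard_lt_ncard ?_ ((hE.subset hHG.edgeSet_mono).subset Set.sdiff_subset)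
        refine ⟨Set.sdiff_subset_sdiff_right hXX, fun hsub => ?_⟩
        exact (hsub ⟨heH, heX⟩).2 heX'
      obtain ⟨S'', X'', 𝒟'', h1, h2, h3, h4⟩ :=
        ih _ hlt h' hs' (he₀.imp_left fun h => hXX h) rfl
      exact ⟨S'', X'', 𝒟'', h1, fun h => heX₀ (h2 h), hDD.trans h3, h4⟩

end Stage

end Completion

end Graph

namespace Graph

open FinOrientation

section Assembly

variable {α β : Type*} {G : Graph α β}

lemma IsEdgeConnected.exists_isLink (hG : G.IsEdgeConnected 3) {Z : Set α} {z v : α}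
    (hz : z ∈ Z) (hzG : z ∈ V(G)) (hv : v ∉ Z) (hvG : v ∈ V(G)) (e₁ e₂ : β) :
    ∃ e x y, e ≠ e₁ ∧ e ≠ e₂ ∧ G.IsLink e x y ∧ x ∈ Z ∧ y ∉ Z := by
  by_contra hcon
  have hconn := (hG.2 (({e₁, e₂} : Set β) ∩ E(G)) Set.inter_subset_right (by
    refine lt_of_le_of_lt (Set.encard_le_encard Set.inter_subset_left) ?_
    refine lt_of_le_of_lt (Set.encard_insert_le _ _) ?_
    rw [Set.encard_singleton]
    norm_num)).2 z (by simpa using hzG) v (by simpa using hvG)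
  have key : ∀ w, Relation.ReflTransGen (G.deleteEdges (({e₁, e₂} : Set β) ∩ E(G))).Adj z w →
      w ∈ Z := by
    intro w hw
    induction hw with
    | refl => exact hz
    | @tail x y _ hxy ih =>
      obtain ⟨e, he⟩ := hxy
      by_contra hy
      have heG := he.mono deleteEdges_le
      have h2 : e ∉ ({e₁, e₂} : Set β) ∩ E(G) := he.edge_mem.2
      refine hcon ⟨e, x, y, ?_, ?_, heG, ih, hy⟩ <;> rintro rfl <;>
        exact h2 ⟨by simp, heG.edge_mem⟩
  exact hv (key v hconn)

lemma IsEdgeConnected.hasLargeCuts (hG : G.IsEdgeConnected 3) {s : α} (hs : s ∈ V(G)) (t : α) :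
    G.HasLargeCuts s t := by
  rintro Z hZ ⟨z, hz⟩ hsZ
  refine ⟨fun e₁ => ?_, fun _ e₁ e₂ => hG.exists_isLink hz (hZ hz) hsZ hs e₁ e₂⟩
  obtain ⟨e, x, y, h1, -, h⟩ := hG.exists_isLink hz (hZ hz) hsZ hs e₁ e₁
  exact ⟨e, x, y, h1, h⟩

lemma IsEdgeConnected.hasLargeCuts_deleteEdges (hG : G.IsEdgeConnected 3) {s t : α} {e₀ : β}
    (he₀ : G.IsLink e₀ s t) : (G.deleteEdges {e₀}).HasLargeCuts s t := by
  rintro Z hZ ⟨z, hz⟩ hsZ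
  have hzG : z ∈ V(G) := by simpa using hZ hz
  constructor
  · intro e₁
    obtain ⟨e, x, y, h1, h2, hl, hxy⟩ := hG.exists_isLink hz hzG hsZ he₀.left_mem e₁ e₀
    exact ⟨e, x, y, h1, by simpa using ⟨hl, h2⟩, hxy⟩
  · intro ht e₁ e₂
    obtain ⟨e, x, y, h1, h2, hl, hx, hy⟩ := hG.exists_isLink hz hzG hsZ he₀.left_mem e₁ e₂
    have hne : e ≠ e₀ := by
      rintro rfl
      rcases hl.left_eq_or_eq he₀ with rfl | rfl <;> contradiction
    exact ⟨e, x, y, h1, h2, by simpa using ⟨hl, hne⟩, hx, hy⟩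

lemma IsEdgeConnected.exists_isPathOn (hG : G.IsEdgeConnected 3) {s t : α} {e₀ : β}
    (he₀ : G.IsLink e₀ s t) : ∃ V E, (G.deleteEdges {e₀}).IsPathOn s t V E := by
  refine exists_isPathOn_of_cut (by simpa using he₀.left_mem) fun R _ hs ht => ?_
  obtain ⟨e, x, y, h1, -, hl, hxy⟩ :=
    hG.exists_isLink hs he₀.left_mem ht he₀.right_mem e₀ e₀
  exact ⟨e, x, y, by simpa using ⟨hl, h1⟩, hxy⟩

lemma IsEdgeConnected.three_le (hG : G.IsEdgeConnected 3) (hE : E(G).Finite) {Δ : ℕ} (e₀ : β)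
    (hΔ : ∀ v, {e ∈ E(G) | G.Inc e v}.ncard ≤ Δ) : 3 ≤ Δ := by
  classical
  obtain ⟨v, hv, w, hw, hvw⟩ := hG.1
  have hcut := fun e₁ e₂ => hG.exists_isLink (Z := {v}) rfl hv (fun h => hvw h.symm) hw e₁ e₂
  obtain ⟨e₁, _, _, -, -, h1, hx₁, -⟩ := hcut e₀ e₀
  obtain ⟨e₂, _, _, h21, -, h2, hx₂, -⟩ := hcut e₁ e₁
  obtain ⟨e₃, _, _, h31, h32, h3, hx₃, -⟩ := hcut e₁ e₂
  refine le_trans ?_ (hΔ v)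
  have hcard : ({e₁, e₂, e₃} : Finset β).card = 3 := by
    rw [Finset.card_eq_three]
    exact ⟨e₁, e₂, e₃, h21.symm, h31.symm, h32.symm, rfl⟩
  rw [← hcard, ← Set.ncard_coe_finset]
  refine Set.ncard_le_ncard ?_ (hE.subset fun e he => he.1)
  intro e he
  simp only [Finset.coe_insert, Finset.coe_singleton, Set.mem_insert_iff,
    Set.mem_singleton_iff] at he
  rcases he with rfl | rfl | rfl
  exacts [⟨h1.edge_mem, hx₁ ▸ h1.inc_left⟩, ⟨h2.edge_mem, hx₂ ▸ h2.inc_left⟩,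
    ⟨h3.edge_mem, hx₃ ▸ h3.inc_left⟩]

lemma HasMaxDegree.ncard_le {Δ : ℕ} (hΔ : G.HasMaxDegree Δ) (v : α) :
    {e ∈ E(G) | G.Inc e v}.ncard ≤ Δ := by
  by_cases hv : v ∈ V(G)
  · have h1 : {e ∈ E(G) | G.Inc e v} = G.incidenceSet v :=
      Set.ext fun e => ⟨fun h => h.2, fun h => ⟨Inc.edge_mem h, h⟩⟩
    have h2 : G.vertexDegree v ≤ Δ := hΔ.2 ⟨v, hv, rfl⟩
    rw [h1]
    exact le_trans (Nat.le_add_right _ _) h2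
  · have h1 : {e ∈ E(G) | G.Inc e v} = ∅ :=
      Set.eq_empty_of_forall_notMem fun e h => hv h.2.vertex_mem
    simp [h1]

namespace FinOrientation

variable {A : Type*} [AddCommGroup A] (O : G.FinOrientation) {e e₀ : β} {s t v x y : α}

lemma exists_of_isLink (hE : E(G).Finite) (he₀ : G.IsLink e₀ s t) :
    ∃ O : G.FinOrientation, O.tail e₀ = s ∧ O.head e₀ = t := by
  classical
  have h : ∀ e : β, ∃ p : α × α, (e ∈ E(G) → G.IsLink e p.1 p.2) ∧ (e = e₀ → p = (s, t)) := by
    intro e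
    by_cases h1 : e = e₀
    · exact ⟨(s, t), fun _ => h1 ▸ he₀, fun _ => rfl⟩
    · by_cases h2 : e ∈ E(G)
      · obtain ⟨x, y, h⟩ := exists_isLink_of_mem_edgeSet h2
        exact ⟨(x, y), fun _ => h, fun h => absurd h h1⟩
      · exact ⟨(s, t), fun h => absurd h h2, fun h => absurd h h1⟩
  choose p hp hp₀ using h
  refine ⟨⟨fun e => (p e).1, fun e => (p e).2, hE.toFinset, by simp, hp⟩, ?_, ?_⟩ <;>
    simp [hp₀ e₀ rfl]

/-- The flow given by a circulation. -/
def toGroupFlow (f : β → A) (hf : O.net f = 0) : G.GroupFlow A where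
  tail := O.tail
  head := O.head
  isLink := O.isLink
  val := f
  conservation v hv := by
    classical
    have key : ∀ g : β → α, ∑ᶠ e ∈ {e | e ∈ E(G) ∧ g e = v}, f e =
        ∑ e ∈ O.edges, if g e = v then f e else 0 := by
      intro g
      rw [← Finset.sum_filter, ← finsum_mem_coe_finset]
      congr 1
      ext e
      simp [O.mem_edges]
    have h := congrFun hf v
    rw [net, Finset.sum_sub_distrib, Pi.zero_apply, sub_eq_zero] at h
    rw [key, key, h]

variable {f : β → A} {hf : O.net f = 0}

lemma valAlong_eq_out [G.Loopless] (h : G.IsLink e x y) :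
    (O.toGroupFlow f hf).valAlong e x y = O.out f x e := by
  have hne := h.ne
  rcases O.tail_eq_or h with ⟨h1, h2⟩ | ⟨h1, h2⟩
  · simp [GroupFlow.valAlong, toGroupFlow, out, h1, h2]
  · simp [GroupFlow.valAlong, toGroupFlow, out, h1, h2, hne.symm]

lemma exists_of_contrafluent [G.Loopless] {e' : β} (h : (O.toGroupFlow f hf).Contrafluent e e') :
    e ≠ e' ∧ ∃ v, G.Inc e v ∧ G.Inc e' v ∧ O.out f v e = O.out f v e' := by
  obtain ⟨hne, x, v, y, h1, h2, h3⟩ := h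
  refine ⟨hne, v, h1.inc_right, h2.inc_left, ?_⟩
  rw [O.valAlong_eq_out h1, O.valAlong_eq_out h2] at h3
  rw [O.out_right h1, h3, neg_neg]

lemma out_of_confluent [G.Loopless] {e' : β} (h : (O.toGroupFlow f hf).Confluent e e') :
    e ≠ e' ∧ ∀ w, G.Inc e w → G.Inc e' w → O.out f w e = -O.out f w e' := by
  obtain ⟨hne, x, v, y, h1, h2, h3⟩ := h
  refine ⟨hne, fun w hw hw' => ?_⟩
  rw [O.valAlong_eq_out h1, O.valAlong_eq_out h2] at h3
  rcases hw.eq_or_eq_of_isLink h1 with rfl | rfl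
  · rcases hw'.eq_or_eq_of_isLink h2 with rfl | rfl
    · exact absurd rfl h1.ne
    · rw [h3, O.out_right h2, neg_neg]
  · rw [O.out_right h1, h3]

end FinOrientation

/-- Three edges at a vertex of degree three of the union of two intersecting pairs. -/
lemma StronglyIntersecting.exists_three [G.Loopless] {P : β → β → Prop}
    (hP : ∀ e f, P e f → P f e) {e₁ e₂ f₁ f₂ : β} (he : P e₁ e₂) (hf : P f₁ f₂)
    (h : G.StronglyIntersecting s(e₁, e₂) s(f₁, f₂)) :
    ∃ e g g' v, P e g ∧ P e g' ∧ g ≠ g' ∧ G.Inc e v ∧ G.Inc g v ∧ G.Inc g' v := by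
  classical
  obtain ⟨hne, ⟨x, hx, hx'⟩, v, hv⟩ := h
  have hl : (G.restrict {e | e ∈ s(e₁, e₂) ∨ e ∈ s(f₁, f₂)}).loopSet v = ∅ := by
    ext e
    simp
  rw [vertexDegree, hl, Set.ncard_empty, add_zero] at hv
  have main : ∀ e g g', P e g → P e g' → s(e₁, e₂) = s(e, g) → s(f₁, f₂) = s(e, g') →
      ∃ e g g' v, P e g ∧ P e g' ∧ g ≠ g' ∧ G.Inc e v ∧ G.Inc g v ∧ G.Inc g' v := by
    intro e g g' h1 h2 h3 h4
    have hgg : g ≠ g' := by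
      rintro rfl
      exact hne (h3.trans h4.symm)
    have hsub : (G.restrict {e | e ∈ s(e₁, e₂) ∨ e ∈ s(f₁, f₂)}).incidenceSet v ⊆
        (({e, g, g'} : Finset β) : Set β) := by
      intro a ha
      rw [mem_incidenceSet, restrict_inc, h3, h4] at ha
      have := ha.2
      simp only [Set.mem_ofPred_eq, Sym2.mem_iff] at this
      simp only [Finset.coe_insert, Finset.coe_singleton, Set.mem_insert_iff,
        Set.mem_singleton_iff]
      tauto
    have heq := Set.eq_of_subset_of_ncard_le hsub (by
      rw [hv, Set.ncard_coe_finset]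
      exact Finset.card_le_three) (Finset.finite_toSet _)
    have hinc : ∀ a ∈ ({e, g, g'} : Finset β), G.Inc a v := by
      intro a ha
      have : a ∈ (({e, g, g'} : Finset β) : Set β) := ha
      rw [← heq, mem_incidenceSet, restrict_inc] at this
      exact this.1
    exact ⟨e, g, g', v, h1, h2, hgg, hinc e (by simp), hinc g (by simp), hinc g' (by simp)⟩
  rcases Sym2.mem_iff.1 hx with rfl | rfl <;> rcases Sym2.mem_iff.1 hx' with rfl | rfl
  · exact main _ _ _ he hf rfl rfl
  · exact main _ _ _ he (hP _ _ hf) rfl Sym2.eq_swap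
  · exact main _ _ _ (hP _ _ he) hf Sym2.eq_swap rfl
  · exact main _ _ _ (hP _ _ he) (hP _ _ hf) Sym2.eq_swap Sym2.eq_swap

section Combine

variable {O : G.FinOrientation} {k : ℕ} {S : Set α} {𝒟 : List (List (Set α × Set β))}
  {f : β → ZMod k} {e e' : β} {v : α}

/-- The pair of a function and the indicator of the chain edges. -/
noncomputable def withParity (f : β → ZMod k) (D : Set β) (e : β) : ZMod k × ZMod 2 :=
  (f e, parity D e)

lemma net_withParity (O : G.FinOrientation) {D : Set β} (hf : O.net f = 0)
    (hD : O.net (parity D) = 0) : O.net (withParity f D) = 0 := by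
  ext v
  · have := congrFun hf v
    simp only [net, Pi.zero_apply] at this
    simp only [net, Prod.fst_sum, Pi.zero_apply, Prod.fst_zero]
    rw [← this]
    refine Finset.sum_congr rfl fun e _ => ?_
    split_ifs <;> simp [withParity]
  · have := congrFun hD v
    simp only [net, Pi.zero_apply] at this
    simp only [net, Prod.snd_sum, Pi.zero_apply, Prod.snd_zero]
    rw [← this]
    refine Finset.sum_congr rfl fun e _ => ?_
    split_ifs <;> simp [withParity]

lemma out_withParity_fst (O : G.FinOrientation) (D : Set β) :
    (O.out (withParity f D) v e).1 = O.out f v e := by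
  simp only [out]
  split_ifs <;> rfl

lemma out_withParity_snd (O : G.FinOrientation) (D : Set β) :
    (O.out (withParity f D) v e).2 = parity D e := by
  simp only [out]
  split_ifs
  · rfl
  · simp [withParity, ZMod.neg_eq_self_mod_two]

lemma mem_iff_of_parity_eq {D : Set β} (h : parity D e = parity D e') : e ∈ D ↔ e' ∈ D := by
  simp only [parity] at h
  split_ifs at h <;> simp_all

lemma eq_or_neg_of_out (h : O.out f v e = O.out f v e') : f e = f e' ∨ f e = -f e' := by
  simp only [out] at h
  split_ifs at h
  · exact Or.inl h
  · exact Or.inr h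
  · exact Or.inr (by rw [← h, neg_neg])
  · exact Or.inl (neg_injective h)

lemma eq_or_neg_of_out_neg (h : O.out f v e = -O.out f v e') : f e = f e' ∨ f e = -f e' := by
  simp only [out] at h
  split_ifs at h
  · exact Or.inr h
  · exact Or.inl (by rw [h, neg_neg])
  · exact Or.inl (neg_injective h)
  · exact Or.inr (neg_injective h)

/-- Two chain edges at a vertex belong to the same chain. -/
lemma IsChainSystem.exists_common (h : IsChainSystem O S 𝒟) (he : e ∈ chainsEdges 𝒟)
    (he' : e' ∈ chainsEdges 𝒟) (hv : G.Inc e v) (hv' : G.Inc e' v) :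
    ∃ L ∈ 𝒟, (∃ C ∈ L, e ∈ C.2) ∧ ∃ C ∈ L, e' ∈ C.2 := by
  obtain ⟨L, hL, C, hC, heC⟩ := he
  obtain ⟨L', hL', C', hC', heC'⟩ := he'
  have h1 : v ∈ listVertices L :=
    ⟨C, hC, ((h.isChainList L hL).1.isCircuitPair hC).mem_of_inc heC hv⟩
  have h2 : v ∈ listVertices L' :=
    ⟨C', hC', ((h.isChainList L' hL').1.isCircuitPair hC').mem_of_inc heC' hv'⟩
  by_cases hLL : L = L'
  · exact ⟨L, hL, ⟨C, hC, heC⟩, C', hLL ▸ hC', heC'⟩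
  · have : Std.Symm (fun L L' : List (Set α × Set β) =>
        Disjoint (listVertices L) (listVertices L')) := ⟨fun _ _ h => h.symm⟩
    exact absurd h2 (Set.disjoint_left.1 (h.pairwise.forall hL hL' hLL) h1)

lemma IsChainSystem.exists_circuit (h : IsChainSystem O S 𝒟) (hsep : ∀ L ∈ 𝒟, G.Separates f L)
    (he : e ∈ chainsEdges 𝒟) (he' : e' ∈ chainsEdges 𝒟) (hv : G.Inc e v) (hv' : G.Inc e' v)
    (hf : f e = f e' ∨ f e = -f e') :
    ∃ L ∈ 𝒟, ∃ C ∈ L, e ∈ C.2 ∧ e' ∈ C.2 := by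
  obtain ⟨L, hL, ⟨C, hC, heC⟩, C', hC', heC'⟩ := h.exists_common he he' hv hv'
  by_cases hCC : C = C'
  · exact ⟨L, hL, C, hC, heC, hCC ▸ heC'⟩
  · have := hsep L hL C hC C' hC' hCC e heC e' heC' v hv hv'
    tauto

/-- A circuit of a chain system is determined by any of its edges. -/
lemma IsChainSystem.circuit_unique [G.Loopless] (h : IsChainSystem O S 𝒟)
    {L L' : List (Set α × Set β)}
    (hL : L ∈ 𝒟) (hL' : L' ∈ 𝒟) {C C' : Set α × Set β} (hC : C ∈ L) (hC' : C' ∈ L')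
    (he : e ∈ C.2) (he' : e ∈ C'.2) (hsep : ∀ L ∈ 𝒟, G.Separates f L) : C = C' := by
  by_contra hCC
  have hCp := (h.isChainList L hL).1.isCircuitPair hC
  have hCp' := (h.isChainList L' hL').1.isCircuitPair hC'
  obtain ⟨x, y, hl⟩ := exists_isLink_of_mem_edgeSet (hCp.mem_edgeSet he)
  have h1 : x ∈ listVertices L := ⟨C, hC, hCp.mem_of_isLink he hl⟩
  have h2 : x ∈ listVertices L' := ⟨C', hC', hCp'.mem_of_isLink he' hl⟩
  by_cases hLL : L = L'
  · subst hLL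
    exact (hsep L hL C hC C' hC' hCC e he e he' x hl.inc_left hl.inc_left).1 rfl
  · have : Std.Symm (fun L L' : List (Set α × Set β) =>
        Disjoint (listVertices L) (listVertices L')) := ⟨fun _ _ h => h.symm⟩
    exact absurd h2 (Set.disjoint_left.1 (h.pairwise.forall hL hL' hLL) h1)

lemma exists_flow_of_isGood [G.Loopless] (hD : IsChainSystem O S 𝒟) (hf : O.net f = 0)
    (hne : ∀ e ∈ E(G), e ∉ chainsEdges 𝒟 → f e ≠ 0)
    (hout : ∀ e ∈ E(G), e ∉ chainsEdges 𝒟 → ∀ e' ∈ E(G), e' ∉ chainsEdges 𝒟 → e' ≠ e →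
      ∀ v, G.Inc e v → G.Inc e' v → O.out f v e ≠ O.out f v e')
    (hsep : ∀ L ∈ 𝒟, G.Separates f L) {e₀ : β} {s t : α} (he₀ : G.IsLink e₀ s t)
    (hs : O.tail e₀ = s) :
    ∃ φ : G.GroupFlow (ZMod k × ZMod 2), φ.NowhereZero ∧
      φ.valAlong e₀ s t = (f e₀, parity (chainsEdges 𝒟) e₀) ∧
      (∀ e₁ e₂ f₁ f₂ : β, φ.Confluent e₁ e₂ → φ.Confluent f₁ f₂ →
        ¬ G.StronglyIntersecting s(e₁, e₂) s(f₁, f₂)) ∧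
      ∃ 𝒟 : Set G.CircuitChain,
        φ.ChainEdgesInduce 𝒟 ∧ ∀ e f : β, φ.Contrafluent e f → G.ConsecutiveOn 𝒟 e f := by
  classical
  set Φ := withParity f (chainsEdges 𝒟) with hΦ
  have hΦ0 : O.net Φ = 0 := net_withParity O hf hD.net_parity
  have claim : ∀ e e' v, e ≠ e' → G.Inc e v → G.Inc e' v → O.out Φ v e = O.out Φ v e' →
      ∃ L ∈ 𝒟, ∃ C ∈ L, e ∈ C.2 ∧ e' ∈ C.2 := by
    intro e e' v hee hv hv' heq
    have h1 := congrArg Prod.fst heq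
    have h2 := congrArg Prod.snd heq
    rw [out_withParity_fst, out_withParity_fst] at h1
    rw [out_withParity_snd, out_withParity_snd] at h2
    by_cases he : e ∈ chainsEdges 𝒟
    · exact hD.exists_circuit hsep he ((mem_iff_of_parity_eq h2).1 he) hv hv' (eq_or_neg_of_out h1)
    · exact absurd h1 (hout e hv.edge_mem he e' hv'.edge_mem
        (fun h => he ((mem_iff_of_parity_eq h2).2 h)) hee.symm v hv hv')
  choose F hF1 hF2 hF3 using fun (L : List (Set α × Set β)) (hL : L ∈ 𝒟) =>
    (hD.isChainList L hL).1.exists_circuitChain (hD.isChainList L hL).2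
  refine ⟨O.toGroupFlow Φ hΦ0, ?_, ?_, ?_, {D | ∃ L hL, F L hL = D}, ⟨?_, ?_⟩, ?_⟩
  · intro e he h0
    have h0 : Φ e = 0 := h0
    have h1 := congrArg Prod.fst h0
    have h2 := congrArg Prod.snd h0
    by_cases heD : e ∈ chainsEdges 𝒟
    · simp [hΦ, withParity, parity, heD] at h2
    · exact hne e he heD h1
  · rw [O.valAlong_eq_out he₀]
    simp [out, hs, hΦ, withParity]
  · intro e₁ e₂ f₁ f₂ h1 h2 hS
    obtain ⟨e, g, g', v, ⟨heg, heg'⟩, ⟨heh, heh'⟩, hgg, hev, hgv, hgv'⟩ :=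
      hS.exists_three (P := fun e e' => e ≠ e' ∧ ∀ w, G.Inc e w → G.Inc e' w →
        O.out Φ w e = -O.out Φ w e')
        (fun e e' h => ⟨h.1.symm, fun w h1 h2 => by rw [h.2 w h2 h1, neg_neg]⟩)
        (O.out_of_confluent h1) (O.out_of_confluent h2)
    have k1 := heg' v hev hgv
    have k2 := heh' v hev hgv'
    obtain ⟨L, hL, C, hC, hgC, hgC'⟩ := claim g g' v hgg hgv hgv' (neg_injective (k1 ▸ k2))
    have j1 := congrArg Prod.fst k1
    have j2 := congrArg Prod.snd k1
    rw [Prod.fst_neg, out_withParity_fst, out_withParity_fst] at j1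
    rw [Prod.snd_neg, out_withParity_snd, out_withParity_snd, ZMod.neg_eq_self_mod_two] at j2
    have hgD : g ∈ chainsEdges 𝒟 := ⟨L, hL, C, hC, hgC⟩
    obtain ⟨L', hL', C', hC', heC, hgC2⟩ := hD.exists_circuit hsep
      ((mem_iff_of_parity_eq j2).2 hgD) hgD hev hgv (eq_or_neg_of_out_neg j1)
    obtain rfl := hD.circuit_unique hL hL' hC hC' hgC hgC2 hsep
    have hCp := (hD.isChainList L hL).1.isCircuitPair hC
    obtain ⟨a, -, b, -, -, hab⟩ := hCp.exists_pair (hCp.mem_of_inc heC hev)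
    have i1 := (hab e heC).1 hev
    have i2 := (hab g hgC).1 hgv
    have i3 := (hab g' hgC').1 hgv'
    grind
  · rintro _ ⟨L, hL, rfl⟩ _ ⟨L', hL', rfl⟩ hne
    have : Std.Symm (fun L L' : List (Set α × Set β) =>
        Disjoint (listVertices L) (listVertices L')) := ⟨fun _ _ h => h.symm⟩
    have := hD.pairwise.forall hL hL' (by rintro rfl; exact hne rfl)
    have hv : ∀ L : List (Set α × Set β), ⋃ C ∈ L, C.1 = listVertices L := by
      intro L; ext v; simp [listVertices]
    rw [Function.onFun, hF1 L hL, hF1 L' hL', hv, hv]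
    exact this
  · ext e
    simp only [GroupFlow.chainEdges, Set.mem_ofPred_eq, Set.mem_iUnion]
    have : ((O.toGroupFlow Φ hΦ0).val e).2 = 1 ↔ e ∈ chainsEdges 𝒟 := by
      simp [toGroupFlow, hΦ, withParity, parity]
    rw [this]
    constructor
    · rintro ⟨-, L, hL, C, hC, he⟩
      refine ⟨F L hL, ⟨L, hL, rfl⟩, ?_⟩
      rw [hF2 L hL]
      exact Set.mem_biUnion hC he
    · rintro ⟨_, ⟨L, hL, rfl⟩, he⟩
      rw [hF2 L hL] at he
      simp only [Set.mem_iUnion] at he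
      obtain ⟨C, hC, he⟩ := he
      have : e ∈ chainsEdges 𝒟 := ⟨L, hL, C, hC, he⟩
      exact ⟨hD.mem_edgeSet this, this⟩
  · intro e e' hc
    obtain ⟨hee, v, hv, hv', heq⟩ := O.exists_of_contrafluent hc
    obtain ⟨L, hL, C, hC, heC, heC'⟩ := claim e e' v hee hv hv' heq
    obtain ⟨i, hi⟩ := hF3 L hL C hC
    exact ⟨⟨hee, v, hv, hv'⟩, F L hL, ⟨L, hL, rfl⟩, i, hi ▸ heC, hi ▸ heC'⟩

end Combine

namespace Stage

variable {O : G.FinOrientation} {k : ℕ} {e₀ : β} {s t : α}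

lemma singleton (a : ZMod k) (hs : s ∈ V(G)) : Stage O e₀ a {s} ∅ [] where
  subset := by simpa using hs
  edge_mem := by simp
  mem_of_isLink := by simp
  transfer := by
    rintro _ rfl _ rfl
    exact ⟨0, .refl _ _⟩
  chains := ⟨by simp, by simp, by simp, (IsChainSystem.nil (S := (∅ : Set α))).net_parity⟩
  chainsEdges_subset := by simp [chainsEdges]
  flow f _ := ⟨0, O.net_zero, by simp, by simp, by simp, by simp, by simp⟩

lemma circuit [G.Loopless] (a : ZMod k) {C : Set α × Set β} (hC : G.IsCircuitPair C)
    (he₀ : e₀ ∈ C.2) : Stage O e₀ a C.1 C.2 [[C]] where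
  subset := hC.subset
  edge_mem e he := hC.mem_edgeSet he
  mem_of_isLink e he x y hl := hC.mem_of_isLink he hl
  transfer u hu v hv := O.exists_transfer_of_isCircuitPair hC hu hv
  chains := by
    have := IsChainSystem.singleton (O := O) (L := [C]) ⟨hC, trivial, by simp, by simp⟩ (by simp)
    have h : listVertices [C] = C.1 := by ext v; simp [listVertices]
    rwa [h] at this
  chainsEdges_subset := by
    rintro e ⟨L, hL, D, hD, he⟩
    simp only [List.mem_singleton] at hL
    subst hL
    simp only [List.mem_singleton] at hD
    exact hD ▸ he
  flow f _ := by
    obtain ⟨c, hc0, hcs, hcu⟩ := O.exists_circulation hC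
    have hX : ∀ e ∈ C.2, e ∈ chainsEdges [[C]] := fun e he => ⟨[C], by simp, C, by simp, he⟩
    refine ⟨fun e => c e • (c e₀ • (a - f e₀)), O.net_smul_eq_zero hc0 _, fun e he => by
      simp [hcs e he], fun _ => ?_, fun e he h => absurd (hX e he) h,
      fun e he h => absurd (hX e he) h, ?_⟩
    · rcases hcu e₀ he₀ with h | h <;> simp [h]
    · intro L hL D hD D' hD' hne
      simp only [List.mem_singleton] at hL
      subst hL
      simp only [List.mem_singleton] at hD hD'
      exact absurd (hD.trans hD'.symm) hne

end Stage

end Assembly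

end Graph

open Graph FinOrientation in
theorem mainTheorem2 {α β : Type*} (G : Graph α β) [G.Loopless]
    (hV : G.vertexSet.Finite) (hE : G.edgeSet.Finite)
    (hG : G.IsEdgeConnected 3) (Δ : ℕ) (hΔ : G.HasMaxDegree Δ)
    (k : ℕ) (hk : (k : ℤ) = 8 * (Δ : ℤ) - 13)
    (e₀ : β) (s t : α) (he₀ : G.IsLink e₀ s t)
    (a : ZMod k) (b : ZMod 2) (hab : (a, b) ≠ (0, 0)) :
    ∃ φ : G.GroupFlow (ZMod k × ZMod 2),
      φ.NowhereZero ∧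
      φ.valAlong e₀ s t = (a, b) ∧
      (∀ e₁ e₂ f₁ f₂ : β, φ.Confluent e₁ e₂ → φ.Confluent f₁ f₂ →
        ¬ G.StronglyIntersecting s(e₁, e₂) s(f₁, f₂)) ∧
      ∃ 𝒟 : Set G.CircuitChain,
        φ.ChainEdgesInduce 𝒟 ∧
        ∀ e f : β, φ.Contrafluent e f → G.ConsecutiveOn 𝒟 e f := by
  have hdeg := hΔ.ncard_le
  have hΔ3 := hG.three_le hE e₀ hdeg
  have h8 : 8 < k := by omega
  have : NeZero k := ⟨by omega⟩
  obtain ⟨O, hOs, hOt⟩ := exists_of_isLink hE he₀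
  have hkO : IsLargeFor O k Δ := by
    refine ⟨by omega, hΔ3, ⟨((4 * Δ - 6 : ℕ) : ZMod k), ?_⟩, hdeg⟩
    have h1 : (4 * Δ - 6) * 2 = k + 1 := by omega
    have h2 : (((4 * Δ - 6) * 2 : ℕ) : ZMod k) = ((k + 1 : ℕ) : ZMod k) := by rw [h1]
    simpa using h2
  obtain ⟨V, E, hP⟩ := hG.exists_isPathOn he₀
  have hb : b = 0 ∨ b = 1 := by
    exact (show ∀ b : ZMod 2, b = 0 ∨ b = 1 by decide) b
  rcases hb with rfl | rfl
  · have ha : a ≠ 0 := fun h => hab (by rw [h])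
    obtain ⟨S, X, 𝒟, hst, heX, -, hX⟩ := (Stage.singleton (O := O) (e₀ := e₀) a
      he₀.left_mem).exists_complete hkO h8 hV hE (H := G.deleteEdges {e₀}) deleteEdges_le (by simp)
      (hG.hasLargeCuts_deleteEdges he₀) rfl (Or.inr (by simp))
    have heX : e₀ ∉ X := fun h => (heX h).elim
    obtain ⟨c, hc, hcs, -⟩ := O.exists_transfer_of_isLink he₀
    obtain ⟨p, hp, -⟩ := O.exists_transfer_of_isPathOn (hP.mono deleteEdges_le)
    have hpe : p e₀ = 0 := by
      refine hp.1 e₀ fun h => ?_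
      obtain ⟨x, y, hl, -⟩ := hP.ends_mem h
      simpa using hl.edge_mem
    have hce : (c - p) e₀ = 1 := by
      simpa [out, hOs, hpe] using hcs
    have hcp : O.net (c - p) = 0 := by rw [net_sub, hc.2, hp.2, sub_self]
    obtain ⟨g, hg, hgs, hgood⟩ := hst.flow _ (O.net_smul_eq_zero hcp a)
    set f := (fun e => (c - p) e • a) + g with hf
    have hfe : f e₀ = a := by
      simp only [hf, Pi.add_apply, hgs e₀ heX, hce, one_smul, add_zero]
    have hmem : ∀ e ∈ G.edgeSet, e ∈ X ∨ e = e₀ := by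
      intro e he
      by_cases h : e = e₀
      · exact Or.inr h
      · exact Or.inl (hX ⟨he, h⟩)
    have he₀D : e₀ ∉ chainsEdges 𝒟 := fun h => heX (hst.chainsEdges_subset h)
    have := exists_flow_of_isGood hst.chains (f := f)
      (by rw [hf, net_add, hg, O.net_smul_eq_zero hcp a, add_zero])
      (fun e he heD => by
        rcases hmem e he with h | rfl
        · exact hgood.ne_zero e h heD
        · rwa [hfe])
      (fun e he heD e' he' heD' hne v hv hv' => by
        rcases hmem e he with h | rfl
        · exact hgood.out_ne e h heD e' he' heD' hne v hv hv'
        · exact (hgood.out_ne e' ((hmem e' he').resolve_right hne) heD' e he heD hne.symm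
            v hv' hv).symm)
      hgood.separates he₀ hOs
    rwa [hfe, parity, if_neg he₀D] at this
  · have hC := IsCircuitPair.of_isPathOn he₀ hP
    obtain ⟨S, X, 𝒟, hst, -, hD, hX⟩ := (Stage.circuit (O := O) a hC
      (e₀ := e₀) (by simp)).exists_complete hkO h8 hV hE (H := G) le_rfl rfl
      (hG.hasLargeCuts he₀.left_mem t) (by simp) (Or.inl (by simp))
    have he₀D : e₀ ∈ chainsEdges 𝒟 := hD ⟨_, List.mem_singleton_self _, _,
      List.mem_singleton_self _, by simp⟩
    obtain ⟨g, hg, -, hgood⟩ := hst.flow 0 O.net_zero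
    rw [zero_add] at hgood
    have := exists_flow_of_isGood hst.chains hg (fun e he heD => hgood.ne_zero e (hX he) heD)
      (fun e he heD => hgood.out_ne e (hX he) heD) hgood.separates he₀ hOs
    rwa [hgood.value (hX he₀.edge_mem), parity, if_pos he₀D] at this
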